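/- Let $q,\beta\in\mathbb C$ with $0<|q|<1$, $\beta\neq0$, such that $j\beta q^m\neq 1$ for all integers $j\ge1$, $m\ge0$, and $$\sum_{m\ge0} e^{-2\pi d_m}<\infty,\qquad d_m:=\operatorname{dist}\bigl(\beta^{-1}q^{-m},[0,\infty)\bigr)$$ (both conditions hold, for instance, whenever $0<q<1$ and $\beta\in\mathbb C\setminus[0,\infty)$). Let $H_q(z)=\prod_{i\ge0}(1-q^iz)^{-1}$, and for $j\in\mathbb Z$ let $$\rho_j=\beta^j\prod_{i=1}^{j}H_q(i\beta)\quad(j\ge0),\qquad \rho_{-j}=\beta^{-j}\prod_{i=1}^{j-1}\frac1{H_q(-i\beta)}\quad(j\ge1),$$ where $1/H_q$ is taken to be $0$ at the poles of $H_q$. For $k\in\mathbb Z$, $x\in\mathbb C\setminus\{0\}$ and any $\epsilon>0$ put $$\phi_k^{(H_q,\beta)}(x)=\frac{\beta}{2\pi i\,x^{k-1}}\oint_{|\zeta|=\epsilon}\rho(\zeta)\,e^{\beta^{-1}x\zeta}\,\frac{d\zeta}{\zeta^k},\qquad \rho(\zeta)=\sum_{i=-\infty}^{k-1}\rho_{-i-1}\zeta^i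 ,$$ and $$A_{H_q,k}(s)=(-\beta)^{1-k}\,\Gamma(1-k-s)\prod_{m=0}^\infty\left((-\beta q^m)^{-s}\,\frac{\Gamma(-\beta^{-1}q^{-m})}{\Gamma(s-\beta^{-1}q^{-m})}\right)$$ with principal powers. Then, for every $k\in\mathbb Z$: 1. The infinite product converges (unconditionally) for every $s\in\mathbb C$, and $A_{H_q,k}$ is holomorphic on $\mathbb C\setminus\{1-k,2-k,3-k,\dots\}$. 2. The series $\rho(\zeta)$ converges absolutely for every $\zeta\ne0$, and for all $x\neq0$ and $\epsilon>0$, with an absolutely convergent series, $$\phi_k^{(H_q,\beta)}(x)=\beta x^{1-k}\sum_{j=0}^\infty\frac{\rho_{j-k}}{j!}\Bigl(\frac x\beta\Bigr)^j .$$ 3. For all $x\in\mathbb C\setminus\{0\}$, $$\phi_k^{(H_q,\beta)}(x)=\frac1{2\pi i}\int_{\mathcal C_k}A_{H_q,k}(s)\,(-x)^s\,ds ,$$ where $(-x)^s=e^{s\ell}$ for an arbitrary choice of $\ell$ with $e^{\ell}=-x$, and the integral converges absolutely. Here $\mathcal C_k$ is any Hankel-type contour around the poles at the integers $1-k,2-k,\dots$: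 for real $a<1-k$ and $\delta>0$ it runs from $+\infty-i\delta$ horizontally to $a-i\delta$, vertically to $a+i\delta$, and horizontally to $+\infty+i\delta$. (With the reversed contour, which encircles the poles counterclockwise, the right-hand side carries a minus sign.) -/

import Mathlib

open Complex MeasureTheory Set

noncomputable section

namespace QuantumHurwitz

/-- The quantum exponential `H_q(z) = ∏_{i ≥ 0} (1 - q^i z)⁻¹`. -/
def quantumExp (q z : ℂ) : ℂ := ∏' i : ℕ, (1 - q ^ i * z)⁻¹

/-- The coefficients `ρ_j`, `j ∈ ℤ`, of a weight generating function `G`: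
`ρ_j = β^j ∏_{i=1}^{j} G(iβ)` for `j ≥ 0` and
`ρ_{-j} = β^{-j} ∏_{i=1}^{j-1} 1 / G(-iβ)` for `j ≥ 1`
(in the second clause `j = n + 1`). -/
def rho (G : ℂ → ℂ) (β : ℂ) : ℤ → ℂ
  | Int.ofNat j => β ^ j * ∏ i ∈ Finset.Icc 1 j, G ((i : ℂ) * β)
  | Int.negSucc n => (β ^ (n + 1))⁻¹ * ∏ i ∈ Finset.Icc 1 n, (G (-(i : ℂ) * β))⁻¹

/-- The terms of `ρ(ζ) = ∑_{i ≤ k-1} ρ_{-i-1} ζ^i`, enumerated by `n = k - 1 - i ≥ 0`. -/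
def rhoTerm (G : ℂ → ℂ) (β : ℂ) (k : ℤ) (ζ : ℂ) (n : ℕ) : ℂ :=
  rho G β ((n : ℤ) - k) * ζ ^ (k - 1 - (n : ℤ))

/-- The Laurent series `ρ(ζ) = ∑_{i ≤ k-1} ρ_{-i-1} ζ^i`. -/
def rhoSeries (G : ℂ → ℂ) (β : ℂ) (k : ℤ) (ζ : ℂ) : ℂ := ∑' n : ℕ, rhoTerm G β k ζ n

/-- The adapted basis function
`φ_k(x) = β / (2πi x^{k-1}) ∮_{|ζ| = ε} ρ(ζ) e^{xζ/β} ζ^{-k} dζ`. -/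
def phi (G : ℂ → ℂ) (β : ℂ) (k : ℤ) (ε : ℝ) (x : ℂ) : ℂ :=
  β / (2 * Real.pi * I * x ^ (k - 1)) *
    ∮ ζ in C(0, ε), rhoSeries G β k ζ * exp (β⁻¹ * x * ζ) / ζ ^ k

/-- The terms of the series `φ_k(x) = β x^{1-k} ∑_j ρ_{j-k} / j! (x/β)^j`. -/
def phiTerm (G : ℂ → ℂ) (β : ℂ) (k : ℤ) (x : ℂ) (j : ℕ) : ℂ :=
  β * x ^ (1 - k) * (rho G β ((j : ℤ) - k) / (j.factorial : ℂ) * (x / β) ^ j)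

/-- The `m`-th factor
`(-β q^m)^{-s} Γ(-β⁻¹ q^{-m}) / Γ(s - β⁻¹ q^{-m})`, with the principal power. At the poles of
the Gamma function in the denominator the value is `0`, as it has to be since `1/Γ` is entire. -/
def kernelFactor (q β s : ℂ) (m : ℕ) : ℂ :=
  (-β * q ^ m) ^ (-s) * Gamma (-(β⁻¹ * (q ^ m)⁻¹)) / Gamma (s - β⁻¹ * (q ^ m)⁻¹)

/-- `A_{H_q,k}(s) = (-β)^{1-k} Γ(1-k-s) ∏_m (-β q^m)^{-s} Γ(-β⁻¹q^{-m}) / Γ(s - β⁻¹q^{-m})`. -/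
def kernel (q β : ℂ) (k : ℤ) (s : ℂ) : ℂ :=
  (-β) ^ (1 - k) * Gamma (1 - (k : ℂ) - s) * ∏' m : ℕ, kernelFactor q β s m

/-- Absolute convergence of the integral of `f` along the Hankel-type contour made of the two
horizontal half-lines `[a, ∞) ± iδ` and the vertical segment from `a - iδ` to `a + iδ`. -/
def HankelIntegrable (f : ℂ → ℂ) (a δ : ℝ) : Prop :=
  IntegrableOn (fun t : ℝ => f (t - δ * I)) (Ioi a) ∧
  IntervalIntegrable (fun y : ℝ => f (a + y * I)) volume (-δ) δ ∧
  IntegrableOn (fun t : ℝ => f (t + δ * I)) (Ioi a)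

/-- The integral `∫ f(s) ds` along that contour, which comes from `+∞ - iδ`, goes left to
`a - iδ`, up to `a + iδ`, and right to `+∞ + iδ`. -/
def hankelIntegral (f : ℂ → ℂ) (a δ : ℝ) : ℂ :=
  -(∫ t in Ioi a, f (t - δ * I)) + (∫ y in (-δ)..δ, f (a + y * I) * I)
    + ∫ t in Ioi a, f (t + δ * I)

end QuantumHurwitz

end

noncomputable section

namespace QuantumHurwitz

open Filter Topology

/-! ### Asymptotics of ratios of Gamma functions -/

/-! Write $F(s)$ for the infinite product in the kernel, without its prefactor. Its $m$-th factor is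
$z^s\Gamma(z)/\Gamma(z+s)$ at $z=-\beta^{-1}q^{-m}$. This is $1+O(1/|z|)$ in the right half plane by
Gauss's product, and the reflection formula adds an error $O(e^{-2\pi|\operatorname{Im} z|})$ in the
left one. The first error is geometric in $m$ and the second is dominated by $e^{-2\pi d_m}$, so $F$
is entire (`exists_summable_norm_kernelFactor_sub_one_le`, `differentiable_kernelProd`).

The recursion of $\Gamma$, applied factor by factor, gives $F(s)=F(s+1)\prod_m(1-q^m s\beta)$.
Together with $F(0)=1$ this forces $F(n+1)\beta^n=\rho_n$ for all integers $n$
(`kernelProd_intCast_add_one`). Hence the residue of $A_{H_q,k}(s)(-x)^s$ at $1-k+j$ is minus the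
$j$-th term of the series for $\phi_k$ (`rectIntegral_kernelExp`); that series comes from
integrating $\rho(\zeta)$ term by term.

Closing the contour rests on decay. Since $d_m\to\infty$, the zeros of $\prod_m(1-q^m s\beta)$ keep
away from the far right of any horizontal strip, and there the product tends to infinity
(`exists_forall_le_norm_qPochInf`). A unit shift of $s$ thus eventually multiplies the integrand by
at most $e^{-1}$ in modulus. The horizontal integrals converge absolutely, vertical sides through
half-integers vanish in the limit, and the residues sum to the series. -/

/-- Since $|\arg u|\le\pi/2$ and $|\arg(1+u^{-1})|<\pi/2$, the arguments add without leaving the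
principal branch. -/
theorem log_add_one_sub_log {u : ℂ} (hu : 0 ≤ u.re) (h2 : 2 ≤ ‖u‖) :
    log (u + 1) - log u = log (1 + u⁻¹) := by
  have hu0 : u ≠ 0 := by
    rintro rfl
    simp at h2
    linarith
  have hv : ‖u⁻¹‖ < 1 := by
    rw [norm_inv]
    exact inv_lt_one_of_one_lt₀ (by linarith)
  have h1 : 1 + u⁻¹ ≠ 0 := slitPlane_ne_zero (mem_slitPlane_of_norm_lt_one hv)
  have hre : 0 < (1 + u⁻¹).re := by
    have := (abs_le.1 (abs_re_le_norm u⁻¹)).1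
    simp only [add_re, one_re]
    linarith
  have e : u + 1 = u * (1 + u⁻¹) := by field_simp
  have ha := abs_le.1 (abs_arg_le_pi_div_two_iff.2 hu)
  have hb := abs_lt.1 (abs_arg_lt_pi_div_two_iff.2 (Or.inl hre))
  rw [e, log_mul hu0 h1 ⟨by linarith, by linarith⟩]
  ring

/-- With $v=1/u$ the exponential is $1-sv+e$ with $e=O(|v|^2)$, so the linear terms cancel and
$-(sv)^2+(1+sv)e$ remains. The lower bound on $|u|$ makes both $|v|$ and $K|v|$ at most $1/2$. -/
theorem norm_gauss_factor_sub_one_le {K : ℝ} {u s : ℂ} (hu : 0 ≤ u.re)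
    (hR : 2 * K + 2 ≤ ‖u‖) (hs : ‖s‖ ≤ K) :
    ‖(1 + s / u) * exp (-s * (log (u + 1) - log u)) - 1‖ ≤ (6 * K ^ 2 + 2 * K) / ‖u‖ ^ 2 := by
  have hK : 0 ≤ K := (norm_nonneg s).trans hs
  have hupos : 0 < ‖u‖ := by linarith
  rw [log_add_one_sub_log hu (by linarith)]
  set v := u⁻¹ with hv
  have hvn : ‖v‖ = ‖u‖⁻¹ := norm_inv u
  have hv2 : ‖v‖ ≤ 1 / 2 := by
    rw [hvn, one_div]
    exact inv_anti₀ (by norm_num) (by linarith)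
  have hKv : (2 * K + 2) * ‖v‖ ≤ 1 := by
    rw [hvn, ← div_eq_mul_inv, div_le_one hupos]
    exact hR
  set t := log (1 + v)
  have hv0 := norm_nonneg v
  have h1 : ‖t - v‖ ≤ ‖v‖ ^ 2 := by
    refine (norm_log_one_add_sub_self_le (by linarith)).trans ?_
    have : (1 - ‖v‖)⁻¹ ≤ 2 := by
      rw [inv_le_comm₀ (by linarith) (by norm_num)]
      linarith
    have := mul_le_mul_of_nonneg_left this (sq_nonneg ‖v‖)
    linarith
  have h2 : ‖t‖ ≤ 3 / 2 * ‖v‖ := norm_log_one_add_half_le_self hv2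
  have h3 : ‖-s * t‖ ≤ K * (3 / 2 * ‖v‖) := by
    rw [norm_mul, norm_neg]
    gcongr
  have h4 : ‖exp (-s * t) - 1 - (-s * t)‖ ≤ (K * (3 / 2 * ‖v‖)) ^ 2 :=
    (norm_exp_sub_one_sub_id_le (by nlinarith)).trans (by gcongr)
  set e := exp (-s * t) - 1 + s * v with he
  have h5 : ‖e‖ ≤ (K * (3 / 2 * ‖v‖)) ^ 2 + K * ‖v‖ ^ 2 := by
    have : e = (exp (-s * t) - 1 - (-s * t)) + (-s) * (t - v) := by
      rw [he]
      ring
    rw [this]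
    refine (norm_add_le _ _).trans (add_le_add h4 ?_)
    rw [norm_mul, norm_neg]
    gcongr
  have h6 : (1 + s / u) * exp (-s * t) - 1 = -(s * v) ^ 2 + (1 + s * v) * e := by
    rw [he, div_eq_mul_inv]
    ring
  have h7 : ‖s * v‖ ≤ K * ‖v‖ := by
    rw [norm_mul]
    gcongr
  have h8 : ‖1 + s * v‖ ≤ 2 := by
    refine (norm_add_le _ _).trans ?_
    rw [norm_one]
    nlinarith
  rw [h6]
  calc ‖-(s * v) ^ 2 + (1 + s * v) * e‖ ≤ ‖s * v‖ ^ 2 + ‖1 + s * v‖ * ‖e‖ := by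
        refine (norm_add_le _ _).trans ?_
        rw [norm_neg, norm_pow, norm_mul (1 + s * v)]
    _ ≤ (K * ‖v‖) ^ 2 + 2 * ((K * (3 / 2 * ‖v‖)) ^ 2 + K * ‖v‖ ^ 2) := by gcongr
    _ ≤ (6 * K ^ 2 + 2 * K) * ‖v‖ ^ 2 := by nlinarith [sq_nonneg (K * ‖v‖)]
    _ = (6 * K ^ 2 + 2 * K) / ‖u‖ ^ 2 := by rw [hvn, inv_pow, div_eq_mul_inv]

theorem norm_sq_add_natCast {z : ℂ} (hz : 0 ≤ z.re) (j : ℕ) :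
    ‖z‖ ^ 2 + (j : ℝ) ^ 2 ≤ ‖z + j‖ ^ 2 := by
  rw [← normSq_eq_norm_sq, ← normSq_eq_norm_sq, normSq_apply, normSq_apply]
  simp only [add_re, natCast_re, add_im, natCast_im]
  have : (0 : ℝ) ≤ j := Nat.cast_nonneg j
  nlinarith [mul_nonneg hz this]

theorem norm_le_norm_add_natCast {z : ℂ} (hz : 0 ≤ z.re) (j : ℕ) : ‖z‖ ≤ ‖z + j‖ := by
  have := norm_sq_add_natCast hz j
  exact le_of_sq_le_sq (by nlinarith [sq_nonneg (j : ℝ)]) (norm_nonneg _)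

/-- $|z+j|^2\ge(r+j)^2/2\ge(r+j)(r+j-1)/2$, and the reciprocals of the last expression telescope. -/
theorem sum_inv_norm_add_natCast_sq_le {z : ℂ} (hz : 0 ≤ z.re) (h2 : 2 ≤ ‖z‖) (n : ℕ) :
    ∑ j ∈ Finset.range n, 1 / ‖z + j‖ ^ 2 ≤ 4 / ‖z‖ := by
  set r := ‖z‖
  have key : ∀ n : ℕ, ∑ j ∈ Finset.range n, 1 / ‖z + j‖ ^ 2
      ≤ 2 / (r - 1) - 2 / (r + n - 1) := by
    intro n
    induction n with
    | zero => simp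
    | succ n ih =>
      rw [Finset.sum_range_succ]
      have hn : (0 : ℝ) ≤ n := Nat.cast_nonneg n
      have h1 : (r + n) ^ 2 / 2 ≤ ‖z + n‖ ^ 2 := by
        have := norm_sq_add_natCast hz n
        nlinarith [sq_nonneg (r - n)]
      have h3 : (r + n) * (r + n - 1) / 2 ≤ ‖z + n‖ ^ 2 := by nlinarith
      have h2 : 1 / ‖z + n‖ ^ 2 ≤ 2 / (r + n - 1) - 2 / (r + (n + 1 : ℕ) - 1) := by
        have h4 : 0 < r + n - 1 := by linarith
        have h5 : 0 < r + n := by linarith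
        calc 1 / ‖z + n‖ ^ 2 ≤ 1 / ((r + n) * (r + n - 1) / 2) :=
              one_div_le_one_div_of_le (by positivity) h3
          _ = _ := by
              push_cast
              rw [show r + (n + 1) - 1 = r + n by ring]
              field_simp
              ring
      linarith
  refine (key n).trans ?_
  have h1 : 2 / (r - 1) ≤ 4 / r := by
    rw [div_le_div_iff₀ (by linarith) (by linarith)]
    linarith
  have h2 : 0 ≤ 2 / (r + n - 1) := by
    have hn : (0 : ℝ) ≤ n := Nat.cast_nonneg n
    exact div_nonneg (by norm_num) (by linarith)
  linarith

theorem tendsto_log_add_natCast_sub_log (z : ℂ) :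
    Tendsto (fun n : ℕ => log (z + n + 1) - log n) atTop (𝓝 0) := by
  have h1 : Tendsto (fun n : ℕ => 1 + (z + 1) / n) atTop (𝓝 1) := by
    simpa using (tendsto_const_nhds (x := (1 : ℂ))).add (tendsto_const_div_atTop_nhds_zero_nat (z + 1))
  have h2 : Tendsto (fun n : ℕ => log (1 + (z + 1) / n)) atTop (𝓝 0) := by
    have := (continuousAt_clog one_mem_slitPlane).tendsto.comp h1
    simpa [Function.comp_def] using this
  refine h2.congr' ?_
  filter_upwards [eventually_gt_atTop 0, h1.eventually_ne one_ne_zero] with n hn hne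
  have hn' : (n : ℂ) ≠ 0 := Nat.cast_ne_zero.2 hn.ne'
  have e : z + n + 1 = ((n : ℝ) : ℂ) * (1 + (z + 1) / n) := by
    push_cast
    field_simp
    ring
  rw [e, log_ofReal_mul (by exact_mod_cast hn) hne, ofReal_log (by positivity)]
  push_cast
  ring

/-- The logarithms telescope, and the rational parts are the denominators of Euler's sequences for
$\Gamma(z)$ and $\Gamma(z+s)$. The final exponential, which tends to $1$, corrects $n^s$ to
$(z+n+1)^s$. -/
theorem prod_gauss_factor {z s : ℂ} (n : ℕ) (hn : n ≠ 0) (hz : ∀ j : ℕ, z + j ≠ 0)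
    (hzs : ∀ j : ℕ, z + s + j ≠ 0) :
    ∏ j ∈ Finset.range (n + 1),
      ((1 + s / (z + j)) * exp (-s * (log (z + j + 1) - log (z + j)))) =
    GammaSeq z n / GammaSeq (z + s) n * z ^ s * exp (-s * (log (z + n + 1) - log n)) := by
  have hz0 : z ≠ 0 := by simpa using hz 0
  have hnC : (n : ℂ) ≠ 0 := Nat.cast_ne_zero.2 hn
  have e1 : ∏ j ∈ Finset.range (n + 1), (1 + s / (z + j)) =
      (∏ j ∈ Finset.range (n + 1), (z + s + j)) / ∏ j ∈ Finset.range (n + 1), (z + j) := by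
    rw [← Finset.prod_div_distrib]
    refine Finset.prod_congr rfl fun j _ => ?_
    have := hz j
    field_simp
    ring
  have e2 : ∏ j ∈ Finset.range (n + 1), exp (-s * (log (z + j + 1) - log (z + j))) =
      exp (-s * (log (z + n + 1) - log z)) := by
    rw [← exp_sum, ← Finset.mul_sum]
    have := Finset.sum_range_sub (fun j : ℕ => log (z + j)) (n + 1)
    push_cast at this
    simp only [← add_assoc, add_zero] at this
    rw [this]
  rw [Finset.prod_mul_distrib, e1, e2, GammaSeq, GammaSeq, cpow_add _ _ hnC,
    cpow_def_of_ne_zero hz0 s, cpow_def_of_ne_zero hnC s]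
  have h1 : ∏ j ∈ Finset.range (n + 1), (z + j) ≠ 0 := Finset.prod_ne_zero_iff.2 fun j _ => hz j
  have h2 : ∏ j ∈ Finset.range (n + 1), (z + s + j) ≠ 0 :=
    Finset.prod_ne_zero_iff.2 fun j _ => hzs j
  have h3 : (n.factorial : ℂ) ≠ 0 := Nat.cast_ne_zero.2 n.factorial_ne_zero
  have h4 : (n : ℂ) ^ z ≠ 0 := by simp [cpow_eq_zero_iff, hnC]
  have e3 : exp (-(s * (log (z + n + 1) - log z))) * exp (s * log n) =
      exp (s * log z) * exp (-(s * (log (z + n + 1) - log n))) := by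
    rw [← exp_add, ← exp_add]
    congr 1
    ring
  have h5 := exp_ne_zero (log n * s)
  field_simp
  linear_combination e3

theorem norm_Gamma_ratio_sub_one_le_of_re_nonneg {K : ℝ} {z s : ℂ} (hz : 0 ≤ z.re)
    (hR : 2 * K + 2 ≤ ‖z‖) (hs : ‖s‖ ≤ K) :
    ‖z ^ s * Gamma z / Gamma (z + s) - 1‖ ≤ Real.exp ((6 * K ^ 2 + 2 * K) * (4 / ‖z‖)) - 1 := by
  have hK : 0 ≤ K := (norm_nonneg s).trans hs
  have hle : ∀ j : ℕ, 2 * K + 2 ≤ ‖z + j‖ := fun j => hR.trans (norm_le_norm_add_natCast hz j)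
  have h0 : ∀ j : ℕ, z + j ≠ 0 := fun j h => by
    have := hle j
    rw [h, norm_zero] at this
    linarith
  have h0s : ∀ j : ℕ, z + s + j ≠ 0 := fun j h => by
    have h1 := hle j
    rw [show z + j = -s by linear_combination h, norm_neg] at h1
    linarith
  have hG : Gamma (z + s) ≠ 0 := Gamma_ne_zero fun m h => h0s m (by rw [h]; ring)
  have hlim : Tendsto (fun n : ℕ => ∏ j ∈ Finset.range (n + 1),
      ((1 + s / (z + j)) * exp (-s * (log (z + j + 1) - log (z + j))))) atTop
      (𝓝 (z ^ s * Gamma z / Gamma (z + s))) := by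
    have h1 := ((GammaSeq_tendsto_Gamma z).div (GammaSeq_tendsto_Gamma (z + s)) hG).mul_const (z ^ s)
    have h2 : Tendsto (fun n : ℕ => exp (-s * (log (z + n + 1) - log n))) atTop (𝓝 1) := by
      have := ((tendsto_log_add_natCast_sub_log z).const_mul (-s)).cexp
      simpa using this
    have h3 := h1.mul h2
    rw [show Gamma z / Gamma (z + s) * z ^ s * 1 = z ^ s * Gamma z / Gamma (z + s) by ring] at h3
    refine h3.congr' ?_
    filter_upwards [eventually_ne_atTop 0] with n hn
    exact (prod_gauss_factor n hn h0 h0s).symm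
  refine le_of_tendsto (hlim.sub_const 1).norm (Eventually.of_forall fun n => ?_)
  set g : ℕ → ℂ := fun j => (1 + s / (z + j)) * exp (-s * (log (z + j + 1) - log (z + j))) - 1
  have e : ∏ j ∈ Finset.range (n + 1),
      ((1 + s / (z + j)) * exp (-s * (log (z + j + 1) - log (z + j)))) =
      ∏ j ∈ Finset.range (n + 1), (1 + g j) :=
    Finset.prod_congr rfl fun j _ => by simp [g]
  rw [e]
  refine (Finset.norm_prod_one_add_sub_one_le _ _).trans ?_
  gcongr
  calc ∑ j ∈ Finset.range (n + 1), ‖g j‖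
      ≤ ∑ j ∈ Finset.range (n + 1), (6 * K ^ 2 + 2 * K) * (1 / ‖z + j‖ ^ 2) := by
        refine Finset.sum_le_sum fun j _ => ?_
        rw [mul_one_div]
        exact norm_gauss_factor_sub_one_le (by simpa using add_nonneg hz (Nat.cast_nonneg j))
          (hle j) hs
    _ ≤ _ := by
        rw [← Finset.mul_sum]
        gcongr
        exact sum_inv_norm_add_natCast_sq_le hz (by linarith) _

/-- `z^s Γ(z) / Γ(z + s) = 1 + O(1 / |z|)` in the closed right half plane, uniformly for bounded
`s`. -/
theorem exists_norm_Gamma_ratio_sub_one_le_of_re_nonneg (K : ℝ) (hK : 0 ≤ K) :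
    ∃ C R : ℝ, 0 < C ∧ 0 < R ∧ ∀ z s : ℂ, 0 ≤ z.re → R ≤ ‖z‖ → ‖s‖ ≤ K →
      ‖z ^ s * Gamma z / Gamma (z + s) - 1‖ ≤ C / ‖z‖ := by
  set D := (6 * K ^ 2 + 2 * K) * 4 with hD
  have hD0 : 0 ≤ D := by positivity
  refine ⟨2 * D + 1, max (2 * K + 2) (D + 1), by linarith, lt_max_of_lt_left (by linarith),
    fun z s hz hR hs => ?_⟩
  have hR1 := (le_max_left _ _).trans hR
  have hR2 := (le_max_right _ _).trans hR
  have hpos : 0 < ‖z‖ := by linarith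
  refine (norm_Gamma_ratio_sub_one_le_of_re_nonneg hz hR1 hs).trans ?_
  rw [show (6 * K ^ 2 + 2 * K) * (4 / ‖z‖) = D / ‖z‖ by rw [hD]; ring]
  have h1 : |D / ‖z‖| ≤ 1 := by
    rw [abs_of_nonneg (by positivity), div_le_one hpos]
    linarith
  have h2 := (le_abs_self _).trans (Real.abs_exp_sub_one_le h1)
  rw [abs_of_nonneg (by positivity)] at h2
  refine h2.trans ?_
  rw [← mul_div_assoc]
  gcongr
  linarith

/-- For either sign $\sigma$, $\sin v=\frac{\sigma i}{2}e^{-\sigma iv}(1-e^{2\sigma iv})$. The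
freedom in $\sigma$ allows the exponential in $z$ to be the decaying one. -/
theorem sin_add_div_sin_mul_exp {z s : ℂ} {σ : ℂ} (hσ : σ = 1 ∨ σ = -1)
    (h1 : sin (Real.pi * z) ≠ 0) :
    sin (Real.pi * (z + s)) / sin (Real.pi * z) * exp (σ * Real.pi * I * s) =
      (1 - exp (2 * Real.pi * σ * I * z) * exp (2 * Real.pi * σ * I * s)) /
        (1 - exp (2 * Real.pi * σ * I * z)) := by
  have key : ∀ v : ℂ, sin v = (σ * I / 2) * exp (-(σ * I * v)) * (1 - exp (2 * σ * I * v)) := by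
    intro v
    have e : exp (-(σ * I * v)) * exp (2 * σ * I * v) = exp (σ * I * v) := by
      rw [← exp_add]
      congr 1
      ring
    rw [mul_assoc, mul_sub, e, Complex.sin]
    rcases hσ with rfl | rfl
    · rw [show -v * I = -(1 * I * v) by ring, show v * I = 1 * I * v by ring]
      ring
    · rw [show -v * I = -1 * I * v by ring, show v * I = -(-1 * I * v) by ring]
      ring
  have h2 := h1
  rw [key] at h2
  rw [key (Real.pi * (z + s)), key (Real.pi * z)]
  rw [show exp (-(σ * I * (Real.pi * (z + s)))) =
    exp (-(σ * I * (Real.pi * z))) * (exp (σ * Real.pi * I * s))⁻¹ by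
      rw [← exp_neg, ← exp_add]; congr 1; ring]
  rw [← exp_add, show 2 * σ * I * (Real.pi * (z + s)) =
    2 * Real.pi * σ * I * z + 2 * Real.pi * σ * I * s by ring,
    show 2 * σ * I * (Real.pi * z) = 2 * Real.pi * σ * I * z by ring] at *
  have h3 := exp_ne_zero (σ * Real.pi * I * s)
  have h4 := left_ne_zero_of_mul h2
  have h5 := right_ne_zero_of_mul h2
  rw [div_mul_eq_mul_div, div_eq_div_iff h2 h5]
  field_simp

theorem sin_pi_mul_ne_zero {z : ℂ} (hz : z.im ≠ 0) : sin (Real.pi * z) ≠ 0 := by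
  intro h
  rw [Complex.sin_eq_zero_iff] at h
  obtain ⟨k, hk⟩ := h
  have := congrArg im hk
  simp [Real.pi_ne_zero] at this
  exact hz this

theorem Gamma_mul_Gamma_neg {z : ℂ} (hz : z.im ≠ 0) :
    Gamma z * Gamma (-z) = -Real.pi / (z * sin (Real.pi * z)) := by
  have hz0 : z ≠ 0 := fun h => hz (by simp [h])
  have h := Gamma_mul_Gamma_one_sub z
  rw [show 1 - z = -z + 1 by ring, Gamma_add_one _ (neg_ne_zero.2 hz0)] at h
  have hs := sin_pi_mul_ne_zero hz
  rw [eq_div_iff (mul_ne_zero hz0 hs)]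
  rw [eq_div_iff hs] at h
  linear_combination -h

/-- The reflection formula for `z^s Γ(z) / Γ(z + s)`. -/
theorem Gamma_ratio_mul_Gamma_ratio_neg {z s : ℂ} (hz : z.im ≠ 0) (hzs : (z + s).im ≠ 0) :
    ∃ σ : ℂ, (σ = 1 ∨ σ = -1) ∧ ‖exp (2 * Real.pi * σ * I * z)‖ = Real.exp (-(2 * Real.pi * |z.im|)) ∧
      (z ^ s * Gamma z / Gamma (z + s)) * ((-z) ^ (-s) * Gamma (-z) / Gamma (-z + -s)) =
        (1 + s / z) * ((1 - exp (2 * Real.pi * σ * I * z) * exp (2 * Real.pi * σ * I * s)) /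
        (1 - exp (2 * Real.pi * σ * I * z))) := by
  have hz0 : z ≠ 0 := fun h => hz (by simp [h])
  have hzs0 : z + s ≠ 0 := fun h => hzs (by simp [h])
  -- $\sigma$ is the sign of $\operatorname{Im} z$: the same choice makes the exponential small and
  -- gives the branch jump between $\log z$ and $\log(-z)$.
  obtain ⟨σ, hσ, hE, hlog⟩ : ∃ σ : ℂ, (σ = 1 ∨ σ = -1) ∧
      ‖exp (2 * Real.pi * σ * I * z)‖ = Real.exp (-(2 * Real.pi * |z.im|)) ∧
      log z - log (-z) = σ * Real.pi * I := by
    rcases lt_or_gt_of_ne hz with h | h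
    · refine ⟨-1, Or.inr rfl, ?_, ?_⟩
      · rw [norm_exp, abs_of_neg h]
        simp
      · rw [Complex.log, Complex.log, norm_neg, arg_neg_eq_arg_add_pi_of_im_neg h]
        push_cast
        ring
    · refine ⟨1, Or.inl rfl, ?_, ?_⟩
      · rw [norm_exp, abs_of_pos h]
        simp
      · rw [Complex.log, Complex.log, norm_neg, arg_neg_eq_arg_sub_pi_of_im_pos h]
        push_cast
        ring
  refine ⟨σ, hσ, hE, ?_⟩
  have hs1 := sin_pi_mul_ne_zero hz
  have hs2 := sin_pi_mul_ne_zero hzs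
  rw [← sin_add_div_sin_mul_exp hσ hs1, ← hlog]
  have e1 : z ^ s * (-z) ^ (-s) = exp ((log z - log (-z)) * s) := by
    rw [cpow_def_of_ne_zero hz0, cpow_def_of_ne_zero (neg_ne_zero.2 hz0), ← exp_add]
    congr 1
    ring
  have e2 : (z ^ s * Gamma z / Gamma (z + s)) * ((-z) ^ (-s) * Gamma (-z) / Gamma (-z + -s)) =
      (z ^ s * (-z) ^ (-s)) * ((Gamma z * Gamma (-z)) / (Gamma (z + s) * Gamma (-(z + s)))) := by
    rw [show -(z + s) = -z + -s by ring]
    ring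
  rw [e2, e1, Gamma_mul_Gamma_neg hz, Gamma_mul_Gamma_neg hzs]
  have hpi : (Real.pi : ℂ) ≠ 0 := ofReal_ne_zero.2 Real.pi_ne_zero
  field_simp

/-- `z^s Γ(z) / Γ(z + s) = 1 + O(1 / |z| + e^{-2π |Im z|})` in the left half plane, away from the
real axis, uniformly for bounded `s`. -/
theorem exists_norm_Gamma_ratio_sub_one_le_of_re_nonpos (K : ℝ) (hK : 0 ≤ K) :
    ∃ C R : ℝ, 0 < C ∧ 0 < R ∧ ∀ z s : ℂ, z.re ≤ 0 → R ≤ |z.im| → ‖s‖ ≤ K →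
      ‖z ^ s * Gamma z / Gamma (z + s) - 1‖ ≤
        C * (1 / ‖z‖ + Real.exp (-(2 * Real.pi * |z.im|))) := by
  obtain ⟨C, R, hC, hR, H⟩ := exists_norm_Gamma_ratio_sub_one_le_of_re_nonneg K hK
  set M := Real.exp (2 * Real.pi * K) with hM
  have hM1 : 1 ≤ M := Real.one_le_exp (by positivity)
  refine ⟨2 * (C + K + (1 + K) * (2 * (1 + M))), max (max R (2 * C)) (K + 1), by positivity,
    lt_max_of_lt_right (by linarith), fun z s hz hzR hs => ?_⟩
  have h1 := (le_max_left _ _).trans ((le_max_left _ _).trans hzR)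
  have h2 := (le_max_right _ _).trans ((le_max_left _ _).trans hzR)
  have h3 := (le_max_right _ _).trans hzR
  have hzn := abs_im_le_norm z
  have hpos : 0 < ‖z‖ := by linarith
  have hzim : z.im ≠ 0 := by
    intro h
    rw [h, abs_zero] at h3
    linarith
  have hzsim : (z + s).im ≠ 0 := by
    intro h
    rw [add_im] at h
    have : |z.im| = |s.im| := by rw [show z.im = -s.im by linarith, abs_neg]
    have := abs_im_le_norm s
    linarith
  obtain ⟨σ, hσ, hE, hprod⟩ := Gamma_ratio_mul_Gamma_ratio_neg hzim hzsim
  -- $-z$ lies in the right half plane, so the ratio $b$ there is already known to be near $1$; the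
  -- reflection identity is then solved for $a$.
  have hb := H (-z) (-s) (by simpa using hz) (by rw [norm_neg]; linarith) (by rwa [norm_neg])
  rw [norm_neg] at hb
  set a := z ^ s * Gamma z / Gamma (z + s)
  set b := (-z) ^ (-s) * Gamma (-z) / Gamma (-z + -s)
  set E := exp (2 * Real.pi * σ * I * z)
  set S := exp (2 * Real.pi * σ * I * s)
  set η := Real.exp (-(2 * Real.pi * |z.im|))
  have hη : η ≤ 1 / 2 := by
    have h4 : Real.exp (-(2 * Real.pi * |z.im|)) ≤ Real.exp (-1) := by
      refine Real.exp_le_exp.2 ?_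
      have := Real.pi_gt_three
      nlinarith
    have := Real.exp_neg_one_lt_half
    simp only [η]
    linarith
  have hS : ‖S‖ ≤ M := by
    rw [hM, norm_exp]
    refine Real.exp_le_exp.2 ((re_le_norm _).trans ?_)
    have : ‖σ‖ = 1 := by rcases hσ with rfl | rfl <;> simp
    simp only [norm_mul, this, norm_I, norm_real, Real.norm_eq_abs, abs_of_pos Real.pi_pos]
    norm_num
    gcongr
  have hbn : 1 / 2 ≤ ‖b‖ := by
    have h4 : C / ‖z‖ ≤ 1 / 2 := by
      rw [div_le_div_iff₀ hpos (by norm_num)]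
      linarith
    have := norm_sub_norm_le 1 (1 - b)
    rw [sub_sub_cancel, norm_one, norm_sub_rev] at this
    linarith
  have hE1 : 1 / 2 ≤ ‖1 - E‖ := by
    have := norm_sub_norm_le 1 E
    rw [norm_one, hE] at this
    linarith
  have hE0 : 1 - E ≠ 0 := norm_pos_iff.1 (by linarith)
  have hb0 : b ≠ 0 := norm_pos_iff.1 (by linarith)
  set T := (1 - E * S) / (1 - E)
  have hT : ‖T - 1‖ ≤ 2 * (1 + M) * η := by
    have : T - 1 = E * (1 - S) / (1 - E) := by
      simp only [T]
      field_simp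
      ring
    rw [this, norm_div, norm_mul, hE]
    calc η * ‖1 - S‖ / ‖1 - E‖ ≤ η * (1 + M) / (1 / 2) := by
          gcongr
          refine (norm_sub_le _ _).trans ?_
          rw [norm_one]
          linarith
      _ = _ := by ring
  have hsz : ‖s / z‖ ≤ K / ‖z‖ := by
    rw [norm_div]
    gcongr
  have hK1 : K / ‖z‖ ≤ K := div_le_self hK (by linarith)
  have hT2 : ‖(1 + s / z) * T - 1‖ ≤ K / ‖z‖ + (1 + K) * (2 * (1 + M) * η) := by
    rw [show (1 + s / z) * T - 1 = s / z + (1 + s / z) * (T - 1) by ring]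
    refine (norm_add_le _ _).trans ?_
    rw [norm_mul]
    have : ‖1 + s / z‖ ≤ 1 + K := by
      refine (norm_add_le _ _).trans ?_
      rw [norm_one]
      linarith
    gcongr
  have ha : a - 1 = (((1 + s / z) * T - 1) - (b - 1)) / b := by
    rw [← hprod]
    field_simp
    ring
  rw [ha, norm_div]
  calc ‖((1 + s / z) * T - 1) - (b - 1)‖ / ‖b‖
      ≤ ((K / ‖z‖ + (1 + K) * (2 * (1 + M) * η)) + C / ‖z‖) / (1 / 2) := by
        gcongr
        exact (norm_sub_le _ _).trans (add_le_add hT2 hb)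
    _ = 2 * ((C + K) * (1 / ‖z‖) + (1 + K) * (2 * (1 + M)) * η) := by ring
    _ ≤ _ := by
        have hη0 : 0 ≤ η := (Real.exp_pos _).le
        have h5 : 0 ≤ 1 / ‖z‖ := by positivity
        have h6 : 0 ≤ (1 + K) * (2 * (1 + M)) := by positivity
        nlinarith [mul_nonneg (add_nonneg hC.le hK) hη0, mul_nonneg h6 h5]

/-! ### The infinite product of kernel factors -/

/-- The closed half-line `[0, ∞)` in the complex plane. -/
abbrev posRay : Set ℂ := (fun t : ℝ => (t : ℂ)) '' Set.Ici (0 : ℝ)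

/-- The points `β⁻¹ q^{-m}`, i.e. the zeros of `s ↦ ∏ (1 - q^m β s)`. -/
abbrev pole (q β : ℂ) (m : ℕ) : ℂ := β⁻¹ * (q ^ m)⁻¹

theorem infDist_posRay_le_norm_sub (w : ℂ) {t : ℝ} (ht : 0 ≤ t) :
    Metric.infDist w posRay ≤ ‖w - t‖ := by
  rw [← dist_eq_norm]
  exact Metric.infDist_le_dist_of_mem ⟨t, ht, rfl⟩

theorem infDist_posRay_le_norm (w : ℂ) : Metric.infDist w posRay ≤ ‖w‖ := by
  simpa using infDist_posRay_le_norm_sub w le_rfl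

theorem infDist_posRay_le_abs_im {w : ℂ} (hw : 0 ≤ w.re) :
    Metric.infDist w posRay ≤ |w.im| := by
  refine (infDist_posRay_le_norm_sub w hw).trans_eq ?_
  have : w - (w.re : ℂ) = w.im * I := by
    apply Complex.ext <;> simp
  rw [this, norm_mul, norm_I, mul_one, norm_real, Real.norm_eq_abs]

theorem tendsto_infDist_pole {q β : ℂ}
    (hdist : Summable fun m : ℕ => Real.exp (-(2 * Real.pi *
      Metric.infDist (pole q β m) posRay))) :
    Tendsto (fun m => Metric.infDist (pole q β m) posRay) atTop atTop := by
  have h := Real.tendsto_exp_comp_nhds_zero.1 hdist.tendsto_atTop_zero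
  have h2 := tendsto_neg_atBot_atTop.comp h
  have h3 := h2.const_mul_atTop (show (0 : ℝ) < (2 * Real.pi)⁻¹ by positivity)
  refine h3.congr fun m => ?_
  have := Real.pi_ne_zero
  simp only [Function.comp, neg_neg]
  field_simp

theorem one_div_norm_pole (q β : ℂ) (m : ℕ) : 1 / ‖pole q β m‖ = ‖β‖ * ‖q‖ ^ m := by
  simp [pole, mul_comm]

theorem summable_one_div_norm_pole {q β : ℂ} (hq1 : ‖q‖ < 1) :
    Summable fun m : ℕ => 1 / ‖pole q β m‖ := by
  simp only [one_div_norm_pole]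
  exact (summable_geometric_of_lt_one (norm_nonneg q) hq1).mul_left _

/-- Inversion commutes with the principal power except on the negative axis, that is, when the pole
is a positive real. Since $d_m\to\infty$, this happens for finitely many $m$ only. -/
theorem kernelFactor_eq_Gamma_ratio {q β s : ℂ} {m : ℕ} (h : (-pole q β m).arg ≠ Real.pi) :
    kernelFactor q β s m =
      (-pole q β m) ^ s * Gamma (-pole q β m) / Gamma (-pole q β m + s) := by
  have e : -β * q ^ m = (-pole q β m)⁻¹ := by
    simp [pole, mul_comm]
  rw [kernelFactor, e, inv_cpow _ _ h, cpow_neg, inv_inv, neg_add_eq_sub]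

theorem exists_summable_norm_kernelFactor_sub_one_le {q β : ℂ} (hq1 : ‖q‖ < 1)
    (hdist : Summable fun m : ℕ => Real.exp (-(2 * Real.pi *
      Metric.infDist (pole q β m) posRay))) (K : ℝ) (hK : 0 ≤ K) :
    ∃ u : ℕ → ℝ, Summable u ∧ ∀ᶠ m in atTop, ∀ s : ℂ, ‖s‖ ≤ K →
      ‖kernelFactor q β s m - 1‖ ≤ u m := by
  obtain ⟨C₁, R₁, hC₁, hR₁, H₁⟩ := exists_norm_Gamma_ratio_sub_one_le_of_re_nonneg K hK
  obtain ⟨C₂, R₂, hC₂, hR₂, H₂⟩ := exists_norm_Gamma_ratio_sub_one_le_of_re_nonpos K hK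
  refine ⟨fun m => (C₁ + C₂) * (1 / ‖pole q β m‖ + Real.exp (-(2 * Real.pi *
      Metric.infDist (pole q β m) posRay))),
    ((summable_one_div_norm_pole hq1).add hdist).mul_left _, ?_⟩
  filter_upwards [(tendsto_infDist_pole hdist).eventually_ge_atTop (max R₁ R₂)] with m hm s hs
  have hm1 := (le_max_left _ _).trans hm
  have hm2 := (le_max_right _ _).trans hm
  set w := pole q β m
  set d := Metric.infDist w posRay
  have hd : 0 < Real.exp (-(2 * Real.pi * d)) := Real.exp_pos _
  have hw : 0 ≤ 1 / ‖w‖ := by positivity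
  have harg : (-w).arg ≠ Real.pi := by
    rw [Ne, arg_eq_pi_iff]
    rintro ⟨h1, h2⟩
    rw [neg_re, neg_lt_zero] at h1
    rw [neg_im, neg_eq_zero] at h2
    have := infDist_posRay_le_abs_im h1.le
    rw [h2, abs_zero] at this
    linarith
  rw [kernelFactor_eq_Gamma_ratio harg]
  -- For $\operatorname{Re} w\le 0$ the error $1/|w|$ suffices. Otherwise $d\le|\operatorname{Im}
  -- w|$, which converts the reflection error into $e^{-2\pi d}$.
  rcases le_total w.re 0 with h | h
  · have h1 := H₁ (-w) s (by simpa using h)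
      (by rw [norm_neg]; exact hm1.trans (infDist_posRay_le_norm w)) hs
    refine h1.trans ?_
    rw [norm_neg]
    calc C₁ / ‖w‖ = C₁ * (1 / ‖w‖) := by ring
      _ ≤ _ := by
        gcongr <;> linarith
  · have hi := infDist_posRay_le_abs_im h
    have h1 := H₂ (-w) s (by simpa using h)
      (by rw [neg_im, abs_neg]; exact hm2.trans hi) hs
    refine h1.trans ?_
    rw [norm_neg, neg_im, abs_neg]
    gcongr
    linarith

theorem differentiable_kernelFactor {q β : ℂ} (hq0 : q ≠ 0) (hβ : β ≠ 0) (m : ℕ) :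
    Differentiable ℂ fun s => kernelFactor q β s m := by
  have hb : -β * q ^ m ≠ 0 := mul_ne_zero (neg_ne_zero.2 hβ) (pow_ne_zero _ hq0)
  simp only [kernelFactor, div_eq_mul_inv]
  refine Differentiable.mul (Differentiable.mul ?_ (differentiable_const _)) ?_
  · exact fun s => (differentiableAt_id.neg).const_cpow (Or.inl hb)
  · exact differentiable_one_div_Gamma.comp (differentiable_id.sub_const _)

/-- The infinite product `∏_m (-β q^m)^{-s} Γ(-β⁻¹q^{-m}) / Γ(s - β⁻¹q^{-m})`. -/
def kernelProd (q β s : ℂ) : ℂ := ∏' m : ℕ, kernelFactor q β s m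

section Convergence

variable {q β : ℂ} (hq0 : q ≠ 0) (hq1 : ‖q‖ < 1) (hβ : β ≠ 0)
  (hdist : Summable fun m : ℕ => Real.exp (-(2 * Real.pi *
      Metric.infDist (pole q β m) posRay)))

include hq0 hq1 hβ hdist

theorem hasProdUniformlyOn_kernelFactor {S : Set ℂ} (hS : IsCompact S) :
    HasProdUniformlyOn (fun m s => kernelFactor q β s m) (kernelProd q β) S := by
  obtain ⟨K, hK⟩ := hS.isBounded.exists_norm_le
  obtain ⟨u, hu, h⟩ := exists_summable_norm_kernelFactor_sub_one_le hq1 hdist (max K 0)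
    (le_max_right _ _)
  have := Summable.hasProdUniformlyOn_nat_one_add (f := fun m s => kernelFactor q β s m - 1) hS hu
    (h.mono fun m hm s hs => hm s ((hK s hs).trans (le_max_left _ _)))
    fun m => ((differentiable_kernelFactor hq0 hβ m).sub_const 1).continuous.continuousOn
  have e : kernelProd q β = fun s => ∏' m : ℕ, kernelFactor q β s m := rfl
  rw [e]
  simpa only [add_sub_cancel] using this

theorem multipliable_kernelFactor (s : ℂ) : Multipliable (kernelFactor q β s) :=
  ((hasProdUniformlyOn_kernelFactor hq0 hq1 hβ hdist (isCompact_singleton (x := s))).hasProd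
    (mem_singleton s)).multipliable

theorem differentiable_kernelProd : Differentiable ℂ (kernelProd q β) := by
  rw [← differentiableOn_univ]
  have h : HasProdLocallyUniformlyOn (fun m s => kernelFactor q β s m) (kernelProd q β) univ :=
    hasProdLocallyUniformlyOn_of_forall_compact isOpen_univ fun S _ hS =>
      hasProdUniformlyOn_kernelFactor hq0 hq1 hβ hdist hS
  refine h.tendstoLocallyUniformlyOn_finsetRange.differentiableOn
    (Eventually.of_forall fun n => ?_) isOpen_univ
  exact (Differentiable.fun_finsetProd fun m _ =>
    differentiable_kernelFactor hq0 hβ m).differentiableOn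

end Convergence

/-! ### The functional equation -/

/-- The product `∏_m (1 - q^m z)`. -/
def qPochInf (q z : ℂ) : ℂ := ∏' m : ℕ, (1 - q ^ m * z)

theorem summable_norm_neg_pow_mul {q : ℂ} (hq1 : ‖q‖ < 1) (z : ℂ) :
    Summable fun m : ℕ => ‖-(q ^ m * z)‖ := by
  simp only [norm_neg, norm_mul, norm_pow]
  exact (summable_geometric_of_lt_one (norm_nonneg q) hq1).mul_right _

theorem multipliable_one_sub_pow_mul {q : ℂ} (hq1 : ‖q‖ < 1) (z : ℂ) :
    Multipliable fun m : ℕ => 1 - q ^ m * z := by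
  simpa only [sub_eq_add_neg] using
    multipliable_one_add_of_summable (summable_norm_neg_pow_mul hq1 z)

theorem qPochInf_ne_zero {q : ℂ} (hq1 : ‖q‖ < 1) {z : ℂ} (h : ∀ m : ℕ, 1 - q ^ m * z ≠ 0) :
    qPochInf q z ≠ 0 := by
  simpa only [qPochInf, sub_eq_add_neg] using
    tprod_one_add_ne_zero_of_summable (f := fun m : ℕ => -(q ^ m * z))
      (by simpa only [← sub_eq_add_neg] using h) (summable_norm_neg_pow_mul hq1 z)

/-- This persists at the poles, where both sides are $0$. Inverting once more gives $0$ there, which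
is the convention $1/H_q=0$. -/
theorem quantumExp_eq_inv {q : ℂ} (hq1 : ‖q‖ < 1) (z : ℂ) :
    quantumExp q z = (qPochInf q z)⁻¹ := by
  by_cases h : ∃ m : ℕ, 1 - q ^ m * z = 0
  · obtain ⟨m, hm⟩ := h
    rw [quantumExp, qPochInf, tprod_of_exists_eq_zero ⟨m, by rw [hm, inv_zero]⟩,
      tprod_of_exists_eq_zero ⟨m, hm⟩, inv_zero]
  · push Not at h
    exact ((multipliable_one_sub_pow_mul hq1 z).hasProd.inv₀ (qPochInf_ne_zero hq1 h)).tprod_eq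

theorem qPochInf_zero (q : ℂ) : qPochInf q 0 = 1 := by
  simp [qPochInf]

/-- $1/\Gamma(z)=z/\Gamma(z+1)$ holds for every $z$, poles included, and $-\beta
q^m(s-\beta^{-1}q^{-m})=1-q^m s\beta$. -/
theorem kernelFactor_eq_mul {q β : ℂ} (hq0 : q ≠ 0) (hβ : β ≠ 0) (s : ℂ) (m : ℕ) :
    kernelFactor q β s m = kernelFactor q β (s + 1) m * (1 - q ^ m * (s * β)) := by
  have hb : -β * q ^ m ≠ 0 := mul_ne_zero (neg_ne_zero.2 hβ) (pow_ne_zero _ hq0)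
  have hq : q ^ m ≠ 0 := pow_ne_zero _ hq0
  simp only [kernelFactor, div_eq_mul_inv]
  rw [one_div_Gamma_eq_self_mul_one_div_Gamma_add_one (s - β⁻¹ * (q ^ m)⁻¹),
    show -s = -(s + 1) + 1 by ring, cpow_add _ _ hb, cpow_one,
    show s - β⁻¹ * (q ^ m)⁻¹ + 1 = s + 1 - β⁻¹ * (q ^ m)⁻¹ by ring]
  field_simp
  ring

theorem Gamma_neg_pole_ne_zero {q β : ℂ} (hq0 : q ≠ 0) (hβ : β ≠ 0)
    (hpole : ∀ j m : ℕ, 1 ≤ j → (j : ℂ) * β * q ^ m ≠ 1) (m : ℕ) :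
    Gamma (-(β⁻¹ * (q ^ m)⁻¹)) ≠ 0 := by
  have hq : q ^ m ≠ 0 := pow_ne_zero _ hq0
  refine Gamma_ne_zero fun j h => ?_
  rw [neg_inj] at h
  rcases Nat.eq_zero_or_pos j with rfl | hj
  · simp [hβ, hq0] at h
  · refine hpole j m hj ?_
    rw [← h]
    field_simp

theorem kernelProd_zero {q β : ℂ} (hq0 : q ≠ 0) (hβ : β ≠ 0)
    (hpole : ∀ j m : ℕ, 1 ≤ j → (j : ℂ) * β * q ^ m ≠ 1) : kernelProd q β 0 = 1 := by
  have : ∀ m, kernelFactor q β 0 m = 1 := fun m => by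
    simp [kernelFactor, Gamma_neg_pole_ne_zero hq0 hβ hpole m]
  simp [kernelProd, this]

theorem qPochInf_natCast_mul_ne_zero {q β : ℂ} (hq1 : ‖q‖ < 1)
    (hpole : ∀ j m : ℕ, 1 ≤ j → (j : ℂ) * β * q ^ m ≠ 1) (n : ℕ) :
    qPochInf q (n * β) ≠ 0 := by
  rcases Nat.eq_zero_or_pos n with rfl | hn
  · simp [qPochInf_zero]
  · refine qPochInf_ne_zero hq1 fun m h => hpole n m hn ?_
    linear_combination -h

section FunctionalEquation

variable {q β : ℂ} (hq0 : q ≠ 0) (hq1 : ‖q‖ < 1) (hβ : β ≠ 0)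
  (hdist : Summable fun m : ℕ => Real.exp (-(2 * Real.pi *
      Metric.infDist (pole q β m) posRay)))

include hq0 hq1 hβ hdist

theorem kernelProd_eq_mul (s : ℂ) :
    kernelProd q β s = kernelProd q β (s + 1) * qPochInf q (s * β) := by
  rw [kernelProd, kernelProd, qPochInf, ← (multipliable_kernelFactor hq0 hq1 hβ hdist (s + 1)).tprod_mul
    (multipliable_one_sub_pow_mul hq1 _)]
  exact tprod_congr fun m => kernelFactor_eq_mul hq0 hβ s m

/-- Moving right divides by $\prod_m(1-q^m n\beta)$, which is nonzero by `hpole`. Moving left, in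
`kernelProd_neg_natCast`, only multiplies, so zeros there do no harm. -/
theorem kernelProd_natCast_add_one
    (hpole : ∀ j m : ℕ, 1 ≤ j → (j : ℂ) * β * q ^ m ≠ 1) (n : ℕ) :
    kernelProd q β (n + 1) = ∏ i ∈ Finset.Icc 1 n, quantumExp q (i * β) := by
  have step : ∀ n : ℕ, kernelProd q β (n + 1) = kernelProd q β n * quantumExp q (n * β) := by
    intro n
    rw [kernelProd_eq_mul hq0 hq1 hβ hdist n, quantumExp_eq_inv hq1, mul_assoc,
      mul_inv_cancel₀ (qPochInf_natCast_mul_ne_zero hq1 hpole n), mul_one]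
  induction n with
  | zero =>
    rw [step, quantumExp_eq_inv hq1]
    simp [kernelProd_zero hq0 hβ hpole, qPochInf_zero]
  | succ n ih =>
    rw [step, Finset.prod_Icc_succ_top (by omega), ← ih]
    push_cast
    rfl

theorem kernelProd_neg_natCast
    (hpole : ∀ j m : ℕ, 1 ≤ j → (j : ℂ) * β * q ^ m ≠ 1) (n : ℕ) :
    kernelProd q β (-n) = ∏ i ∈ Finset.Icc 1 n, (quantumExp q (-i * β))⁻¹ := by
  induction n with
  | zero => simp [kernelProd_zero hq0 hβ hpole]
  | succ n ih =>
    rw [kernelProd_eq_mul hq0 hq1 hβ hdist, Finset.prod_Icc_succ_top (by omega), ← ih,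
      quantumExp_eq_inv hq1, inv_inv]
    push_cast
    ring_nf

theorem kernelProd_intCast_add_one
    (hpole : ∀ j m : ℕ, 1 ≤ j → (j : ℂ) * β * q ^ m ≠ 1) (n : ℤ) :
    kernelProd q β (n + 1) * β ^ n = rho (quantumExp q) β n := by
  cases n with
  | ofNat n =>
    have := kernelProd_natCast_add_one hq0 hq1 hβ hdist hpole n
    simp only [rho, Int.ofNat_eq_natCast, Int.cast_natCast, this, zpow_natCast]
    ring
  | negSucc n =>
    have := kernelProd_neg_natCast hq0 hq1 hβ hdist hpole n
    rw [Int.cast_negSucc, zpow_negSucc, rho]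
    push_cast
    rw [show -((n : ℂ) + 1) + 1 = -n by ring, this]
    ring

end FunctionalEquation

/-! ### Growth of `∏_m (1 - q^m z)` -/

theorem qPochInf_eq_one_sub_mul {q : ℂ} (hq1 : ‖q‖ < 1) (z : ℂ) :
    qPochInf q z = (1 - z) * qPochInf q (q * z) := by
  have h := multipliable_one_sub_pow_mul hq1 (q * z)
  have e : ∀ m : ℕ, 1 - q ^ (m + 1) * z = 1 - q ^ m * (q * z) := fun m => by ring
  rw [qPochInf, qPochInf, tprod_eq_zero_mul' (by simpa only [e] using h)]
  simp only [e, pow_zero, one_mul]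

theorem qPochInf_eq_prod_mul {q : ℂ} (hq1 : ‖q‖ < 1) (n : ℕ) (z : ℂ) :
    qPochInf q z = (∏ m ∈ Finset.range n, (1 - q ^ m * z)) * qPochInf q (q ^ n * z) := by
  induction n with
  | zero => simp
  | succ n ih =>
    rw [ih, Finset.prod_range_succ, qPochInf_eq_one_sub_mul hq1 (q ^ n * z),
      show q * (q ^ n * z) = q ^ (n + 1) * z by ring]
    ring

theorem continuousOn_qPochInf {q : ℂ} (hq1 : ‖q‖ < 1) :
    ContinuousOn (qPochInf q) (Metric.closedBall 0 (1 / 2)) := by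
  have h := Summable.hasProdUniformlyOn_nat_one_add (f := fun (m : ℕ) (z : ℂ) => -(q ^ m * z))
    (isCompact_closedBall (0 : ℂ) (1 / 2))
    ((summable_geometric_of_lt_one (norm_nonneg q) hq1).mul_right (1 / 2))
    (Eventually.of_forall fun m z hz => by
      rw [mem_closedBall_zero_iff] at hz
      rw [norm_neg, norm_mul, norm_pow]
      gcongr)
    (fun m => by fun_prop)
  have h2 := h.tendstoUniformlyOn_finsetRange.continuousOn
    (Eventually.of_forall fun n => by fun_prop).frequently
  have e : qPochInf q = fun z => ∏' m : ℕ, (1 + -(q ^ m * z)) := by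
    funext z
    simp only [qPochInf, sub_eq_add_neg]
  rw [e]
  exact h2

theorem exists_le_norm_qPochInf {q : ℂ} (hq1 : ‖q‖ < 1) :
    ∃ c : ℝ, 0 < c ∧ ∀ z : ℂ, ‖z‖ ≤ 1 / 2 → c ≤ ‖qPochInf q z‖ := by
  obtain ⟨z₀, hz₀, hmin⟩ := (isCompact_closedBall (0 : ℂ) (1 / 2)).exists_isMinOn
    ⟨0, by simp⟩ (continuousOn_qPochInf hq1).norm
  refine ⟨‖qPochInf q z₀‖, norm_pos_iff.2 (qPochInf_ne_zero hq1 fun m h => ?_), fun z hz =>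
    hmin (mem_closedBall_zero_iff.2 hz)⟩
  rw [mem_closedBall_zero_iff] at hz₀
  have h1 : ‖q ^ m * z₀‖ = 1 := by rw [← sub_eq_zero.1 h, norm_one]
  rw [norm_mul, norm_pow] at h1
  have h2 : ‖q‖ ^ m ≤ 1 := pow_le_one₀ (norm_nonneg _) hq1.le
  nlinarith [norm_nonneg z₀, norm_nonneg q]

/-- `|∏_m (1 - q^m z)|` tends to infinity with `|z|` as long as `z` keeps away from the zeros. -/
theorem exists_forall_le_norm_qPochInf {q : ℂ} (hq0 : q ≠ 0) (hq1 : ‖q‖ < 1) {b : ℝ} (hb : 0 < b)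
    (M : ℝ) :
    ∃ R : ℝ, ∀ z : ℂ, R ≤ ‖z‖ → (∀ m : ℕ, b * ‖q‖ ^ m ≤ ‖1 - q ^ m * z‖) →
      M ≤ ‖qPochInf q z‖ := by
  obtain ⟨c, hc, hcz⟩ := exists_le_norm_qPochInf hq1
  set r := ‖q‖ with hr
  have hr0 : 0 < r := norm_pos_iff.2 hq0
  -- At most $i$ indices satisfy $1/2<|q^mz|\le 2$, the range where a factor can be small. By
  -- separation these factors cost at most order $|z|^{-i}$; the first $i+1$ factors gain order
  -- $|z|^{i+1}$, leaving the bound $A|z|$.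
  obtain ⟨i, hi⟩ := exists_pow_lt_of_lt_one (show (0 : ℝ) < 1 / 4 by norm_num) hq1
  set A := c * ((r ^ i / 2) ^ (i + 1) * (b * r / 2) ^ i) with hA
  have hApos : 0 < A := by positivity
  refine ⟨max (max 1 (1 / r ^ (2 * i + 1))) (M / A), fun z hz hsep => ?_⟩
  have hz1 : 1 ≤ ‖z‖ := (le_max_left _ _).trans ((le_max_left _ _).trans hz)
  have hz2 : 1 / r ^ (2 * i + 1) ≤ ‖z‖ := (le_max_right _ _).trans ((le_max_left _ _).trans hz)
  have hz3 : M / A ≤ ‖z‖ := (le_max_right _ _).trans hz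
  have hz0 : 0 < ‖z‖ := by linarith
  have hex : ∃ n : ℕ, r ^ n * ‖z‖ ≤ 1 / 2 := by
    obtain ⟨n, hn⟩ := exists_pow_lt_of_lt_one (show 0 < 1 / (2 * ‖z‖) by positivity) hq1
    refine ⟨n, ?_⟩
    rw [lt_div_iff₀ (by positivity)] at hn
    linarith
  classical
  obtain ⟨n, hn, hmin⟩ : ∃ n : ℕ, r ^ n * ‖z‖ ≤ 1 / 2 ∧ ∀ k < n, 1 / 2 < r ^ k * ‖z‖ :=
    ⟨Nat.find hex, Nat.find_spec hex, fun k hk => not_le.1 (Nat.find_min hex hk)⟩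
  have hni : 2 * i + 1 < n := by
    by_contra h
    have h1 : r ^ (2 * i + 1) ≤ r ^ n := pow_le_pow_of_le_one hr0.le hq1.le (not_lt.1 h)
    have h2 : 1 ≤ r ^ (2 * i + 1) * ‖z‖ := by
      rw [div_le_iff₀ (by positivity)] at hz2
      linarith
    nlinarith
  -- The three blocks are $i+1$ large factors, $L$ factors of modulus at least $1$, and $i$ possibly
  -- small ones. The term $1/r^{2i+1}$ in the threshold makes room for them.
  obtain ⟨L, rfl⟩ : ∃ L, n = (i + 1) + L + i := ⟨n - (2 * i + 1), by omega⟩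
  have hlarge : ∀ m, m < (i + 1) + L → 1 ≤ r ^ m * ‖z‖ / 2 := by
    intro m hm
    have h1 := hmin (m + i) (by omega)
    rw [pow_add] at h1
    have : 0 < r ^ m * ‖z‖ := by positivity
    nlinarith
  have hnorm : ∀ m, m < (i + 1) + L → r ^ m * ‖z‖ / 2 ≤ ‖1 - q ^ m * z‖ := by
    intro m hm
    have h1 := norm_sub_norm_le (q ^ m * z) 1
    rw [norm_sub_rev, norm_mul, norm_pow, norm_one, ← hr] at h1
    linarith [hlarge m hm]
  have hP1 : (r ^ i * ‖z‖ / 2) ^ (i + 1) ≤ ∏ m ∈ Finset.range (i + 1), ‖1 - q ^ m * z‖ := by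
    calc _ = ∏ m ∈ Finset.range (i + 1), (r ^ i * ‖z‖ / 2) := by
          rw [Finset.prod_const, Finset.card_range]
      _ ≤ _ := by
        refine Finset.prod_le_prod (fun _ _ => by positivity) fun m hm => ?_
        rw [Finset.mem_range] at hm
        refine le_trans ?_ (hnorm m (by omega))
        have := pow_le_pow_of_le_one hr0.le hq1.le (show m ≤ i by omega)
        gcongr
  have hP2 : 1 ≤ ∏ m ∈ Finset.range L, ‖1 - q ^ (i + 1 + m) * z‖ := by
    calc (1 : ℝ) = ∏ m ∈ Finset.range L, 1 := by simp
      _ ≤ _ := by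
        refine Finset.prod_le_prod (fun _ _ => zero_le_one) fun m hm => ?_
        rw [Finset.mem_range] at hm
        exact (hlarge _ (by omega)).trans (hnorm _ (by omega))
  have hP3 : (b * r / 2 / ‖z‖) ^ i ≤
      ∏ m ∈ Finset.range i, ‖1 - q ^ (i + 1 + L + m) * z‖ := by
    calc _ = ∏ m ∈ Finset.range i, (b * r / 2 / ‖z‖) := by
          rw [Finset.prod_const, Finset.card_range]
      _ ≤ _ := by
        refine Finset.prod_le_prod (fun _ _ => by positivity) fun m hm => ?_
        rw [Finset.mem_range] at hm
        refine le_trans ?_ (hsep _)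
        have h1 := hmin (i + L + i) (by omega)
        have h2 := pow_le_pow_of_le_one hr0.le hq1.le (show i + 1 + L + m ≤ (i + L + i) + 1 by omega)
        rw [pow_succ] at h2
        rw [div_le_iff₀ hz0]
        have h3 : r * (1 / 2) ≤ r * (r ^ (i + L + i) * ‖z‖) := by gcongr
        have h4 : r / 2 ≤ r ^ (i + 1 + L + m) * ‖z‖ := by
          have := mul_le_mul_of_nonneg_right h2 hz0.le
          linarith
        have h5 := mul_le_mul_of_nonneg_left h4 hb.le
        linarith
  rw [qPochInf_eq_prod_mul hq1 (i + 1 + L + i) z, norm_mul, norm_prod, Finset.prod_range_add,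
    Finset.prod_range_add]
  have hlast : c ≤ ‖qPochInf q (q ^ (i + 1 + L + i) * z)‖ :=
    hcz _ (by rw [norm_mul, norm_pow]; exact hn)
  calc M ≤ A * ‖z‖ := by
        rw [div_le_iff₀ hApos] at hz3
        linarith
    _ = (r ^ i * ‖z‖ / 2) ^ (i + 1) * 1 * (b * r / 2 / ‖z‖) ^ i * c := by
        rw [hA, div_pow _ ‖z‖, show r ^ i * ‖z‖ / 2 = r ^ i / 2 * ‖z‖ by ring, mul_pow _ ‖z‖,
          pow_succ ‖z‖]
        field_simp
    _ ≤ _ := by gcongr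

/-- All but finitely many poles are at distance at least $\delta+1$ from $[0,\infty)$, hence at
least $1$ from the right half of the strip. The remaining ones are passed by going far enough right.
-/
theorem exists_forall_one_le_norm_sub_pole {q β : ℂ}
    (hdist : Summable fun m : ℕ => Real.exp (-(2 * Real.pi *
      Metric.infDist (pole q β m) posRay))) (δ : ℝ) :
    ∃ N : ℝ, 0 ≤ N ∧ ∀ s : ℂ, |s.im| ≤ δ → N ≤ s.re → ∀ m : ℕ, 1 ≤ ‖pole q β m - s‖ := by
  obtain ⟨m₀, hm₀⟩ := eventually_atTop.1
    ((tendsto_infDist_pole hdist).eventually_ge_atTop (δ + 1))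
  refine ⟨1 + ∑ m ∈ Finset.range m₀, ‖pole q β m‖, by positivity, fun s hs hN m => ?_⟩
  have hsre : 0 ≤ s.re := le_trans (by positivity) hN
  rcases le_or_gt m₀ m with h | h
  · have h1 := hm₀ m h
    have h2 := infDist_posRay_le_norm_sub (pole q β m) hsre
    have h3 : ‖pole q β m - (s.re : ℂ)‖ ≤ ‖pole q β m - s‖ + |s.im| := by
      have : pole q β m - (s.re : ℂ) = (pole q β m - s) + s.im * I := by
        nth_rewrite 2 [← re_add_im s]
        ring
      rw [this]
      refine (norm_add_le _ _).trans_eq ?_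
      simp
    linarith
  · have h1 := Finset.single_le_sum (f := fun m => ‖pole q β m‖) (fun _ _ => norm_nonneg _)
      (Finset.mem_range.2 h)
    have h2 := norm_sub_norm_le s (pole q β m)
    rw [norm_sub_rev] at h2
    have h3 := re_le_norm s
    linarith

theorem exists_forall_norm_quantumExp_le {q β : ℂ} (hq0 : q ≠ 0) (hq1 : ‖q‖ < 1) (hβ : β ≠ 0)
    (hdist : Summable fun m : ℕ => Real.exp (-(2 * Real.pi *
      Metric.infDist (pole q β m) posRay))) (δ : ℝ) {η : ℝ} (hη : 0 < η) :
    ∃ N : ℝ, 0 ≤ N ∧ ∀ s : ℂ, |s.im| ≤ δ → N ≤ s.re → qPochInf q (s * β) ≠ 0 ∧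
      ‖quantumExp q (s * β)‖ ≤ η := by
  have hb : 0 < ‖β‖ := norm_pos_iff.2 hβ
  obtain ⟨N, hN0, hN⟩ := exists_forall_one_le_norm_sub_pole hdist δ
  obtain ⟨R, hR⟩ := exists_forall_le_norm_qPochInf hq0 hq1 hb η⁻¹
  refine ⟨max N (R / ‖β‖), le_max_of_le_left hN0, fun s hs hNs => ?_⟩
  have h1 := (le_max_left _ _).trans hNs
  have h2 := (le_max_right _ _).trans hNs
  have key : η⁻¹ ≤ ‖qPochInf q (s * β)‖ := by
    refine hR _ ?_ fun m => ?_
    · rw [div_le_iff₀ hb] at h2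
      rw [norm_mul]
      exact h2.trans (by gcongr; exact re_le_norm s)
    · have e : 1 - q ^ m * (s * β) = β * q ^ m * (pole q β m - s) := by
        have : q ^ m ≠ 0 := pow_ne_zero _ hq0
        simp only [pole]
        field_simp
      rw [e, norm_mul, norm_mul, norm_pow]
      exact le_mul_of_one_le_right (by positivity) (hN s hs h1 m)
  have hpos : 0 < ‖qPochInf q (s * β)‖ := (inv_pos.2 hη).trans_le key
  refine ⟨norm_pos_iff.1 hpos, ?_⟩
  rw [quantumExp_eq_inv hq1, norm_inv]
  exact inv_le_of_inv_le₀ hη key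

/-! ### The series `ρ(ζ)` and the power series of `φ_k` -/

theorem rho_natCast_add_one (G : ℂ → ℂ) (β : ℂ) (n : ℕ) :
    rho G β ((n : ℤ) + 1) = rho G β n * (β * G (((n : ℂ) + 1) * β)) := by
  change rho G β (Int.ofNat (n + 1)) = rho G β (Int.ofNat n) * _
  simp only [rho]
  rw [Finset.prod_Icc_succ_top (by omega), pow_succ]
  push_cast
  ring

theorem rho_add_one (G : ℂ → ℂ) (β : ℂ) {n : ℤ} (hn : 0 ≤ n) :
    rho G β (n + 1) = rho G β n * (β * G (((n : ℂ) + 1) * β)) := by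
  lift n to ℕ using hn
  exact_mod_cast rho_natCast_add_one G β n

/-- Ratio test: consecutive terms differ by $\beta H_q((n-k+1)\beta)/\zeta$, and $H_q$ tends to $0$
along these points. They are real multiples of $\beta$, so the strip of width $0$ suffices. -/
theorem summable_rhoTerm {q β : ℂ} (hq0 : q ≠ 0) (hq1 : ‖q‖ < 1) (hβ : β ≠ 0)
    (hdist : Summable fun m : ℕ => Real.exp (-(2 * Real.pi *
      Metric.infDist (pole q β m) posRay))) (k : ℤ) {ζ : ℂ} (hζ : ζ ≠ 0) :
    Summable (rhoTerm (quantumExp q) β k ζ) := by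
  have hb : 0 < ‖β‖ := norm_pos_iff.2 hβ
  have hz : 0 < ‖ζ‖ := norm_pos_iff.2 hζ
  obtain ⟨N, hN0, hN⟩ := exists_forall_norm_quantumExp_le hq0 hq1 hβ hdist 0
    (show 0 < ‖ζ‖ / (2 * ‖β‖) by positivity)
  refine summable_of_ratio_norm_eventually_le (r := 1 / 2) (by norm_num) ?_
  have hlim : ∀ᶠ n : ℕ in atTop, N + k ≤ (n : ℝ) :=
    tendsto_natCast_atTop_atTop.eventually_ge_atTop _
  filter_upwards [hlim] with n hn
  have hnk : 0 ≤ (n : ℤ) - k := by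
    have : (k : ℝ) ≤ (n : ℤ) := by
      push_cast
      linarith
    have := Int.cast_le.1 this
    omega
  have hH := (hN ((((n : ℤ) - k : ℤ) : ℂ) + 1) (by simp) (by
    simp
    linarith)).2
  have e : rhoTerm (quantumExp q) β k ζ (n + 1) =
      (β * quantumExp q (((((n : ℤ) - k : ℤ) : ℂ) + 1) * β) * ζ⁻¹) *
        rhoTerm (quantumExp q) β k ζ n := by
    simp only [rhoTerm]
    rw [show ((n + 1 : ℕ) : ℤ) - k = ((n : ℤ) - k) + 1 by push_cast; ring,
      show k - 1 - ((n + 1 : ℕ) : ℤ) = (k - 1 - n) - 1 by push_cast; ring,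
      rho_add_one _ _ hnk, zpow_sub_one₀ hζ]
    ring
  rw [e, norm_mul]
  gcongr
  rw [norm_mul, norm_mul, norm_inv]
  calc _ ≤ ‖β‖ * (‖ζ‖ / (2 * ‖β‖)) * ‖ζ‖⁻¹ := by gcongr
    _ = 1 / 2 := by field_simp

theorem circleIntegral_exp_div_pow {ε : ℝ} (hε : 0 < ε) (c : ℂ) (n : ℕ) :
    (∮ ζ in C(0, ε), exp (c * ζ) / ζ ^ (n + 1)) = 2 * Real.pi * I * (c ^ n / n.factorial) := by
  have hd : Differentiable ℂ fun ζ : ℂ => exp (c * ζ) := by fun_prop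
  have h := hd.differentiableOn.circleIntegral_one_div_sub_center_pow_smul (c := 0) hε n
  rw [iteratedDeriv_cexp_const_mul] at h
  simp only [sub_zero, smul_eq_mul, mul_zero, exp_zero, mul_one] at h
  rw [show (2 * Real.pi * I * (c ^ n / n.factorial) : ℂ) = 2 * Real.pi * I / n.factorial * c ^ n by
    ring, ← h]
  congr 1
  funext ζ
  ring

/-- The norm of each term of $\rho$ is constant on the circle, so absolute convergence at the point
$\varepsilon$ dominates the whole integral. Powers of $\zeta$ involving $k$ cancel, and Cauchy's
formula evaluates each term independently of $\varepsilon$. -/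
theorem hasSum_phiTerm {q β : ℂ} (hq0 : q ≠ 0) (hq1 : ‖q‖ < 1) (hβ : β ≠ 0)
    (hdist : Summable fun m : ℕ => Real.exp (-(2 * Real.pi *
      Metric.infDist (pole q β m) posRay))) (k : ℤ) {ε : ℝ} (hε : 0 < ε) {x : ℂ} (hx : x ≠ 0) :
    HasSum (phiTerm (quantumExp q) β k x) (phi (quantumExp q) β k ε x) := by
  set G := quantumExp q
  set c := β⁻¹ * x with hc
  have hε0 : (ε : ℂ) ≠ 0 := ofReal_ne_zero.2 hε.ne'
  have hsumε : Summable fun n : ℕ => ‖rhoTerm G β k ε n‖ :=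
    (summable_rhoTerm hq0 hq1 hβ hdist k hε0).norm
  set f : ℕ → ℂ → ℂ := fun n ζ => rhoTerm G β k ζ n * exp (c * ζ) / ζ ^ k with hf
  have hfn : ∀ n ζ, ζ ≠ 0 → f n ζ = rho G β ((n : ℤ) - k) * (exp (c * ζ) / ζ ^ (n + 1)) := by
    intro n ζ hζ
    simp only [hf, rhoTerm]
    have : ζ ^ (k - 1 - (n : ℤ)) = ζ ^ k / ζ ^ (n + 1) := by
      rw [← zpow_natCast, ← zpow_sub₀ hζ]
      congr 1
      push_cast
      ring
    rw [this]
    have := zpow_ne_zero k hζ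
    field_simp
  have hcirc : ∀ θ, circleMap 0 ε θ ≠ 0 := fun θ => circleMap_ne_center hε.ne'
  have key : HasSum (fun n : ℕ => ∮ ζ in C(0, ε), f n ζ)
      (∮ ζ in C(0, ε), rhoSeries G β k ζ * exp (c * ζ) / ζ ^ k) := by
    simp only [circleIntegral]
    refine intervalIntegral.hasSum_integral_of_dominated_convergence
      (fun n _ => ‖rhoTerm G β k ε n‖ * (ε * (Real.exp (‖c‖ * ε) / ε ^ k))) (fun n => ?_)
      (fun n => ?_) ?_ ?_ ?_
    · refine Continuous.aestronglyMeasurable ?_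
      simp only [hf, rhoTerm, deriv_circleMap]
      have h1 : Continuous fun θ => circleMap 0 ε θ ^ (k - 1 - (n : ℤ)) :=
        (continuous_circleMap 0 ε).zpow₀ _ fun θ => Or.inl (hcirc θ)
      have h2 : Continuous fun θ => circleMap 0 ε θ ^ k :=
        (continuous_circleMap 0 ε).zpow₀ _ fun θ => Or.inl (hcirc θ)
      have h3 : Continuous fun θ => circleMap 0 ε θ := continuous_circleMap 0 ε
      have h4 : ∀ θ, circleMap 0 ε θ ^ k ≠ 0 := fun θ => zpow_ne_zero k (hcirc θ)
      fun_prop (disch := exact h4 _)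
    · refine ae_of_all _ fun θ _ => ?_
      have hn : ‖circleMap 0 ε θ‖ = ε := by simp [abs_of_pos hε]
      have hexp : ‖exp (c * circleMap 0 ε θ)‖ ≤ Real.exp (‖c‖ * ε) := by
        refine (norm_exp_le_exp_norm _).trans ?_
        rw [norm_mul, hn]
      have hr : ‖rhoTerm G β k (circleMap 0 ε θ) n‖ = ‖rhoTerm G β k ε n‖ := by
        simp only [rhoTerm, norm_mul, norm_zpow, hn, norm_real, Real.norm_eq_abs, abs_of_pos hε]
      simp only [hf, deriv_circleMap, smul_eq_mul, norm_mul, norm_div, norm_zpow, hr, hn, norm_I,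
        mul_one]
      calc ε * (‖rhoTerm G β k ε n‖ * ‖exp (c * circleMap 0 ε θ)‖ / ε ^ k)
          ≤ ε * (‖rhoTerm G β k ε n‖ * Real.exp (‖c‖ * ε) / ε ^ k) := by gcongr
        _ = _ := by ring
    · exact ae_of_all _ fun θ _ => hsumε.mul_right _
    · exact intervalIntegrable_const
    · refine ae_of_all _ fun θ _ => ?_
      have h := ((summable_rhoTerm hq0 hq1 hβ hdist k (hcirc θ)).hasSum.mul_right
        (exp (c * circleMap 0 ε θ) / circleMap 0 ε θ ^ k)).mul_left (deriv (circleMap 0 ε) θ)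
      simpa only [hf, rhoSeries, smul_eq_mul, mul_div_assoc] using h
  have hint : ∀ n : ℕ, (∮ ζ in C(0, ε), f n ζ) =
      rho G β ((n : ℤ) - k) * (2 * Real.pi * I * (c ^ n / n.factorial)) := by
    intro n
    rw [← circleIntegral_exp_div_pow hε, ← smul_eq_mul, ← circleIntegral.integral_smul]
    refine circleIntegral.integral_congr hε.le fun ζ hζ => ?_
    refine hfn n ζ fun h => ?_
    simp [h] at hζ
    exact hε.ne hζ
  have h := key.mul_left (β / (2 * Real.pi * I * x ^ (k - 1)))
  have e : phiTerm G β k x = fun n : ℕ =>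
      β / (2 * Real.pi * I * x ^ (k - 1)) * ∮ ζ in C(0, ε), f n ζ := by
    funext n
    rw [hint, phiTerm, show (1 - k : ℤ) = -(k - 1) by ring, zpow_neg,
      show x / β = c by rw [hc]; ring]
    have hpi : (Real.pi : ℂ) ≠ 0 := ofReal_ne_zero.2 Real.pi_ne_zero
    have hxk : x ^ (k - 1) ≠ 0 := zpow_ne_zero _ hx
    have hI := I_ne_zero
    field_simp
  rw [e]
  exact h

/-! ### Residues on rectangles symmetric about the real axis -/

/-- The counterclockwise boundary integral over the rectangle `[a, b] × [-δ, δ]`. -/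
def rectIntegral (f : ℂ → ℂ) (a b δ : ℝ) : ℂ :=
  (∫ x : ℝ in a..b, f (x - δ * I)) - (∫ x : ℝ in a..b, f (x + δ * I)) +
    I * (∫ y : ℝ in (-δ)..δ, f (b + y * I)) - I * (∫ y : ℝ in (-δ)..δ, f (a + y * I))

theorem rectIntegral_eq_zero {f : ℂ → ℂ} {a b δ : ℝ}
    (hf : DifferentiableOn ℂ f (uIcc a b ×ℂ uIcc (-δ) δ)) : rectIntegral f a b δ = 0 := by
  have h := integral_boundary_rect_eq_zero_of_differentiableOn f ⟨a, -δ⟩ ⟨b, δ⟩ hf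
  simpa [rectIntegral, sub_eq_add_neg] using h

theorem rectIntegral_add_adjacent {f : ℂ → ℂ} {a b c δ : ℝ}
    (h₁ : Continuous fun x : ℝ => f (x - δ * I)) (h₂ : Continuous fun x : ℝ => f (x + δ * I)) :
    rectIntegral f a b δ + rectIntegral f b c δ = rectIntegral f a c δ := by
  simp only [rectIntegral]
  rw [← intervalIntegral.integral_add_adjacent_intervals (h₁.intervalIntegrable a b)
    (h₁.intervalIntegrable b c), ← intervalIntegral.integral_add_adjacent_intervals
    (h₂.intervalIntegrable a b) (h₂.intervalIntegrable b c)]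
  ring

theorem ofReal_add_mul_I_ne_zero {x y : ℝ} (h : x ≠ 0 ∨ y ≠ 0) : (x : ℂ) + y * I ≠ 0 := by
  intro h0
  have h1 := congrArg re h0
  have h2 := congrArg im h0
  simp at h1 h2
  tauto

/-- The two integrands differ by $2i\delta/(\delta^2+(x-p)^2)$, an arctangent derivative, so no
branch of the complex logarithm is needed. -/
theorem integral_horizontal_inv_sub {a b p δ : ℝ} (hδ : 0 < δ) :
    (∫ x : ℝ in a..b, ((x : ℂ) - δ * I - p)⁻¹) - (∫ x : ℝ in a..b, ((x : ℂ) + δ * I - p)⁻¹) =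
      2 * I * (Real.arctan ((b - p) / δ) - Real.arctan ((a - p) / δ)) := by
  have hδ0 : (δ : ℂ) ≠ 0 := ofReal_ne_zero.2 hδ.ne'
  have n1 : ∀ x : ℝ, (x : ℂ) - δ * I - p ≠ 0 := fun x => by
    have := ofReal_add_mul_I_ne_zero (x := x - p) (y := -δ) (Or.inr (neg_ne_zero.2 hδ.ne'))
    intro h
    apply this
    push_cast
    linear_combination h
  have n2 : ∀ x : ℝ, (x : ℂ) + δ * I - p ≠ 0 := fun x => by
    have := ofReal_add_mul_I_ne_zero (x := x - p) (y := δ) (Or.inr hδ.ne')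
    intro h
    apply this
    push_cast
    linear_combination h
  have c1 : Continuous fun x : ℝ => ((x : ℂ) - δ * I - p)⁻¹ :=
    Continuous.inv₀ (by fun_prop) n1
  have c2 : Continuous fun x : ℝ => ((x : ℂ) + δ * I - p)⁻¹ :=
    Continuous.inv₀ (by fun_prop) n2
  have c3 : Continuous fun x : ℝ => ((x : ℂ) - δ * I - p)⁻¹ - ((x : ℂ) + δ * I - p)⁻¹ := c1.sub c2
  rw [← intervalIntegral.integral_sub (c1.intervalIntegrable _ _) (c2.intervalIntegrable _ _)]
  rw [intervalIntegral.integral_eq_sub_of_hasDerivAt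
    (f := fun x : ℝ => 2 * I * (Real.arctan ((x - p) / δ) : ℂ)) (fun x _ => ?_)
    (c3.intervalIntegrable _ _)]
  · ring
  · have h := ((((hasDerivAt_id x).sub_const p).div_const δ).arctan).ofReal_comp.const_mul (2 * I)
    refine h.congr_deriv ?_
    have hq : (δ : ℂ) ^ 2 + ((x : ℂ) - p) ^ 2 ≠ 0 := by
      have : δ ^ 2 + (x - p) ^ 2 ≠ 0 := by positivity
      exact_mod_cast this
    have e : ((x : ℂ) - δ * I - p) * ((x : ℂ) + δ * I - p) = (δ : ℂ) ^ 2 + ((x : ℂ) - p) ^ 2 := by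
      linear_combination -(δ : ℂ) ^ 2 * I_sq
    rw [inv_sub_inv (n1 x) (n2 x), e]
    push_cast
    simp only [id]
    field_simp
    ring

theorem integral_vertical_inv {u δ : ℝ} (hu : u ≠ 0) :
    (∫ y : ℝ in (-δ)..δ, ((u : ℂ) + y * I)⁻¹) = 2 * Real.arctan (δ / u) := by
  have n1 : ∀ y : ℝ, (u : ℂ) + y * I ≠ 0 := fun y => ofReal_add_mul_I_ne_zero (Or.inl hu)
  have c1 : Continuous fun y : ℝ => ((u : ℂ) + y * I)⁻¹ := Continuous.inv₀ (by fun_prop) n1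
  have huC : (u : ℂ) ≠ 0 := ofReal_ne_zero.2 hu
  rw [intervalIntegral.integral_eq_sub_of_hasDerivAt
    -- The logarithmic part is even in $y$ and cancels between the endpoints.
    (f := fun y : ℝ => (Real.arctan (y / u) : ℂ) - I / 2 * (Real.log (u ^ 2 + y ^ 2) : ℂ))
    (fun y _ => ?_) (c1.intervalIntegrable _ _)]
  · rw [neg_div, Real.arctan_neg, neg_sq]
    push_cast
    ring
  · have hq' : u ^ 2 + y ^ 2 ≠ 0 := by positivity
    have hq : (u : ℂ) ^ 2 + (y : ℂ) ^ 2 ≠ 0 := by exact_mod_cast hq'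
    have h1 := (((hasDerivAt_id y).div_const u).arctan).ofReal_comp
    have h2 := ((((hasDerivAt_id y).pow 2).const_add (u ^ 2)).log hq').ofReal_comp.const_mul (I / 2)
    refine (h1.sub h2).congr_deriv ?_
    have e : ((u : ℂ) + y * I) * ((u : ℂ) - y * I) = (u : ℂ) ^ 2 + (y : ℂ) ^ 2 := by
      linear_combination -(y : ℂ) ^ 2 * I_sq
    have e2 : ((u : ℂ) + y * I)⁻¹ = (u - y * I) / ((u : ℂ) ^ 2 + (y : ℂ) ^ 2) := by
      rw [← e]
      have := n1 y
      have : (u : ℂ) - y * I ≠ 0 := right_ne_zero_of_mul (e.trans_ne hq)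
      field_simp
    rw [e2]
    simp only [id, Pi.pow_apply]
    push_cast
    field_simp

theorem rectIntegral_inv_sub {a b p δ : ℝ} (hδ : 0 < δ) (ha : a < p) (hb : p < b) :
    rectIntegral (fun s => (s - p)⁻¹) a b δ = 2 * Real.pi * I := by
  have hv : ∀ c : ℝ, c ≠ p → (∫ y : ℝ in (-δ)..δ, ((c : ℂ) + y * I - p)⁻¹) =
      2 * Real.arctan (δ / (c - p)) := by
    intro c hc
    rw [← integral_vertical_inv (sub_ne_zero.2 hc)]
    congr 1
    funext y
    push_cast
    ring_nf
  rw [rectIntegral, integral_horizontal_inv_sub hδ, hv b hb.ne', hv a ha.ne]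
  have h1 : Real.arctan (δ / (b - p)) = Real.pi / 2 - Real.arctan ((b - p) / δ) := by
    rw [← inv_div, Real.arctan_inv_of_pos (div_pos (sub_pos.2 hb) hδ)]
  have h2 : Real.arctan (δ / (a - p)) = -(Real.pi / 2) - Real.arctan ((a - p) / δ) := by
    rw [← inv_div, Real.arctan_inv_of_neg (div_neg_of_neg_of_pos (sub_neg.2 ha) hδ)]
  rw [h1, h2]
  push_cast
  ring

theorem rectIntegral_congr {f g : ℂ → ℂ} {a b δ : ℝ}
    (h : ∀ s ∈ uIcc a b ×ℂ uIcc (-δ) δ, s.re = a ∨ s.re = b ∨ s.im = δ ∨ s.im = -δ → f s = g s) :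
    rectIntegral f a b δ = rectIntegral g a b δ := by
  simp only [rectIntegral]
  have hd : -δ ∈ uIcc (-δ) δ := left_mem_uIcc
  have hd' : δ ∈ uIcc (-δ) δ := right_mem_uIcc
  congr 1
  · congr 1
    · congr 1
      · refine intervalIntegral.integral_congr fun x hx => h _ ?_ ?_
        · simpa [mem_reProdIm] using hx
        · simp
      · refine intervalIntegral.integral_congr fun x hx => h _ ?_ ?_
        · simpa [mem_reProdIm] using hx
        · simp
    · congr 1
      refine intervalIntegral.integral_congr fun y hy => h _ ?_ ?_
      · simpa [mem_reProdIm] using hy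
      · simp
  · congr 1
    refine intervalIntegral.integral_congr fun y hy => h _ ?_ ?_
    · simpa [mem_reProdIm] using hy
    · simp

theorem rectIntegral_add {f g : ℂ → ℂ} {a b δ : ℝ}
    (hf : ContinuousOn f ((uIcc a b ×ℂ uIcc (-δ) δ) ∩
      {s | s.re = a ∨ s.re = b ∨ s.im = δ ∨ s.im = -δ}))
    (hg : ContinuousOn g ((uIcc a b ×ℂ uIcc (-δ) δ) ∩
      {s | s.re = a ∨ s.re = b ∨ s.im = δ ∨ s.im = -δ})) :
    rectIntegral (fun s => f s + g s) a b δ = rectIntegral f a b δ + rectIntegral g a b δ := by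
  have key : ∀ {u v : ℝ} {γ : ℝ → ℂ}, Continuous γ →
      (∀ x ∈ uIcc u v, γ x ∈ (uIcc a b ×ℂ uIcc (-δ) δ) ∩
        {s | s.re = a ∨ s.re = b ∨ s.im = δ ∨ s.im = -δ}) →
      (∫ x in u..v, (f (γ x) + g (γ x))) = (∫ x in u..v, f (γ x)) + ∫ x in u..v, g (γ x) :=
    fun hγ hm => intervalIntegral.integral_add (hf.comp hγ.continuousOn hm).intervalIntegrable
      (hg.comp hγ.continuousOn hm).intervalIntegrable
  have m1 : ∀ x ∈ uIcc a b, ((x : ℂ) - δ * I) ∈ ((uIcc a b ×ℂ uIcc (-δ) δ) ∩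
      {s | s.re = a ∨ s.re = b ∨ s.im = δ ∨ s.im = -δ}) := fun x hx => by
    simpa [mem_reProdIm] using hx
  have m2 : ∀ x ∈ uIcc a b, ((x : ℂ) + δ * I) ∈ ((uIcc a b ×ℂ uIcc (-δ) δ) ∩
      {s | s.re = a ∨ s.re = b ∨ s.im = δ ∨ s.im = -δ}) := fun x hx => by
    simpa [mem_reProdIm] using hx
  have m3 : ∀ y ∈ uIcc (-δ) δ, ((b : ℂ) + y * I) ∈ ((uIcc a b ×ℂ uIcc (-δ) δ) ∩
      {s | s.re = a ∨ s.re = b ∨ s.im = δ ∨ s.im = -δ}) := fun y hy => by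
    simpa [mem_reProdIm] using hy
  have m4 : ∀ y ∈ uIcc (-δ) δ, ((a : ℂ) + y * I) ∈ ((uIcc a b ×ℂ uIcc (-δ) δ) ∩
      {s | s.re = a ∨ s.re = b ∨ s.im = δ ∨ s.im = -δ}) := fun y hy => by
    simpa [mem_reProdIm] using hy
  have c1 : Continuous fun x : ℝ => (x : ℂ) - δ * I := by fun_prop
  have c2 : Continuous fun x : ℝ => (x : ℂ) + δ * I := by fun_prop
  have c3 : Continuous fun y : ℝ => (b : ℂ) + y * I := by fun_prop
  have c4 : Continuous fun y : ℝ => (a : ℂ) + y * I := by fun_prop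
  simp only [rectIntegral]
  rw [key c1 m1, key c2 m2, key c3 m3, key c4 m4]
  ring

theorem rectIntegral_const_mul (c : ℂ) (f : ℂ → ℂ) (a b δ : ℝ) :
    rectIntegral (fun s => c * f s) a b δ = c * rectIntegral f a b δ := by
  simp only [rectIntegral, intervalIntegral.integral_const_mul]
  ring

/-- The residue theorem for a simple pole in a rectangle. -/
theorem rectIntegral_eq_of_simple_pole {f g : ℂ → ℂ} {a b p δ : ℝ} (hδ : 0 < δ)
    (ha : a < p) (hb : p < b) (hg : DifferentiableOn ℂ g (uIcc a b ×ℂ uIcc (-δ) δ))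
    (hfg : ∀ s ∈ uIcc a b ×ℂ uIcc (-δ) δ, s ≠ p → f s = g s / (s - p)) :
    rectIntegral f a b δ = 2 * Real.pi * I * g p := by
  have hbd : ∀ s : ℂ, (s.re = a ∨ s.re = b ∨ s.im = δ ∨ s.im = -δ) → s ≠ p := by
    rintro s h rfl
    simp only [ofReal_re, ofReal_im] at h
    rcases h with h | h | h | h <;> linarith
  have hmem : uIcc a b ×ℂ uIcc (-δ) δ ∈ 𝓝 (p : ℂ) := by
    rw [← mem_interior_iff_mem_nhds, interior_reProdIm, uIcc_of_le (by linarith),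
      uIcc_of_le (by linarith), interior_Icc, interior_Icc, mem_reProdIm]
    exact ⟨⟨ha, hb⟩, by simpa using hδ⟩
  have hd : DifferentiableOn ℂ (dslope g p) (uIcc a b ×ℂ uIcc (-δ) δ) :=
    (differentiableOn_dslope hmem).2 hg
  -- Splits $g(s)/(s-p)$ into a holomorphic difference quotient and $g(p)/(s-p)$.
  have e : rectIntegral f a b δ =
      rectIntegral (fun s => dslope g p s + g p * (s - p)⁻¹) a b δ := by
    refine rectIntegral_congr fun s hs hs' => ?_
    have hne := sub_ne_zero.2 (hbd s hs')
    rw [hfg s hs (hbd s hs'), dslope_of_ne _ (hbd s hs'), slope_def_field]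
    field_simp
    ring
  rw [e, rectIntegral_add, rectIntegral_eq_zero hd, rectIntegral_const_mul,
    rectIntegral_inv_sub hδ ha hb]
  · ring
  · exact hd.continuousOn.mono inter_subset_left
  · refine ContinuousOn.mul continuousOn_const (ContinuousOn.inv₀ (by fun_prop) ?_)
    exact fun s hs => sub_ne_zero.2 (hbd s hs.2)

/-! ### The poles of the Gamma factor -/

/-- Induction through $\Gamma(-u)=\Gamma(-(u-1))/(-u)$, which carries the pole at $j$ to the one at
$j+1$. The numerator stays holomorphic up to the next pole, as the rectangle residue theorem needs.
-/
theorem exists_Gamma_neg_eq_div (j : ℕ) :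
    ∃ h : ℂ → ℂ, DifferentiableOn ℂ h {u | u.re < j + 1 ∧ ∀ i < j, u ≠ (i : ℂ)} ∧
      h j = -((-1) ^ j / (j.factorial : ℂ)) ∧
      ∀ u : ℂ, (∀ i < j, u ≠ (i : ℂ)) → u ≠ j → Gamma (-u) = h u / (u - j) := by
  induction j with
  | zero =>
    refine ⟨fun u => -Gamma (1 - u), ?_, by simp, fun u _ hu => ?_⟩
    · rintro u ⟨hu, -⟩
      refine DifferentiableAt.differentiableWithinAt (DifferentiableAt.neg ?_)
      refine (differentiableAt_Gamma _ fun m hm => ?_).comp u (differentiableAt_id.const_sub 1)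
      have := congrArg re hm
      simp only [sub_re, one_re, neg_re, natCast_re] at this
      have : (0 : ℝ) ≤ m := Nat.cast_nonneg m
      simp only [Nat.cast_zero, zero_add] at hu
      linarith
    · simp only [Nat.cast_zero, sub_zero] at hu ⊢
      rw [show 1 - u = -u + 1 by ring, Gamma_add_one _ (neg_ne_zero.2 hu)]
      field_simp
  | succ j ih =>
    obtain ⟨h, hd, hv, hG⟩ := ih
    refine ⟨fun u => h (u - 1) / (-u), ?_, ?_, fun u hu huj => ?_⟩
    · have hmaps : MapsTo (fun u : ℂ => u - 1)
          {u | u.re < (j + 1 : ℕ) + 1 ∧ ∀ i < j + 1, u ≠ (i : ℂ)}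
          {u | u.re < j + 1 ∧ ∀ i < j, u ≠ (i : ℂ)} := by
        rintro u ⟨hu, hi⟩
        push_cast at hu
        refine ⟨by simp only [sub_re, one_re]; linarith, fun i hij h => ?_⟩
        refine hi (i + 1) (by omega) ?_
        push_cast
        linear_combination h
      refine DifferentiableOn.div (hd.comp (by fun_prop) hmaps) (by fun_prop) ?_
      rintro u ⟨-, hi⟩
      simpa using hi 0 (by omega)
    · have h0 : (j : ℂ) + 1 ≠ 0 := Nat.cast_add_one_ne_zero j
      have h1 : (j.factorial : ℂ) ≠ 0 := Nat.cast_ne_zero.2 j.factorial_ne_zero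
      simp only [Nat.factorial_succ]
      push_cast
      rw [add_sub_cancel_right, hv, pow_succ]
      field_simp
    · have hu0 : u ≠ 0 := by simpa using hu 0 (by omega)
      have h1 := hG (u - 1) (fun i hij h => hu (i + 1) (by omega) (by
        push_cast
        linear_combination h)) (fun h => huj (by
        push_cast
        linear_combination h))
      have h2 := Gamma_add_one (-u) (neg_ne_zero.2 hu0)
      rw [show -u + 1 = -(u - 1) by ring, h1] at h2
      push_cast at huj ⊢
      have h3 : u - (j + 1) ≠ 0 := sub_ne_zero.2 huj
      have h4 : u - 1 - j ≠ 0 := by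
        rw [sub_sub, add_comm (1 : ℂ)]
        exact h3
      rw [show u - (j + 1) = u - 1 - j by ring]
      field_simp at h2 ⊢
      linear_combination h2

/-! ### Integrals of functions with geometric decay -/

/-- Every $t\ge N$ is an integer translate of a point of $[N,N+1]$, where $f$ is bounded; iterating
the hypothesis gives $f=O(e^{-t})$. -/
theorem integrableOn_Ioi_of_norm_add_one_le {f : ℝ → ℂ} (hf : Continuous f) {N : ℝ}
    (h : ∀ t, N ≤ t → ‖f (t + 1)‖ ≤ Real.exp (-1) * ‖f t‖) (a : ℝ) : IntegrableOn f (Ioi a) := by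
  obtain ⟨M, hM⟩ := (isCompact_Icc (a := N) (b := N + 1)).exists_bound_of_continuousOn
    hf.continuousOn
  have hM0 : 0 ≤ M := (norm_nonneg _).trans (hM N ⟨le_rfl, by linarith⟩)
  have hn : ∀ n : ℕ, ∀ t, N ≤ t → ‖f (t + n)‖ ≤ Real.exp (-n) * ‖f t‖ := by
    intro n t ht
    induction n with
    | zero => simp
    | succ n ih =>
      have h1 := h (t + n) (by linarith [(Nat.cast_nonneg n : (0 : ℝ) ≤ n)])
      push_cast
      rw [← add_assoc]
      calc _ ≤ Real.exp (-1) * ‖f (t + n)‖ := h1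
        _ ≤ Real.exp (-1) * (Real.exp (-n) * ‖f t‖) := by gcongr
        _ = _ := by
          rw [← mul_assoc, ← Real.exp_add]
          ring_nf
  have hbound : ∀ t, N ≤ t → ‖f t‖ ≤ M * Real.exp (N + 1) * Real.exp (-1 * t) := by
    intro t ht
    have h1 := Nat.floor_le (sub_nonneg.2 ht)
    have h2 := Nat.lt_floor_add_one (t - N)
    set n := ⌊t - N⌋₊
    have h3 := hn n (t - n) (by linarith)
    rw [sub_add_cancel] at h3
    refine h3.trans ?_
    have h4 := hM (t - n) ⟨by linarith, by linarith⟩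
    rw [mul_assoc, ← Real.exp_add, mul_comm]
    refine mul_le_mul h4 (Real.exp_le_exp.2 (by linarith)) (Real.exp_pos _).le hM0
  have h1 : IntegrableOn (fun t => ‖f t‖) (Ioi a) := by
    refine integrable_of_isBigO_exp_neg one_pos hf.norm.continuousOn ?_
    refine Asymptotics.IsBigO.of_bound (M * Real.exp (N + 1)) ?_
    filter_upwards [eventually_ge_atTop N] with t ht
    rw [norm_norm, Real.norm_eq_abs, Real.abs_exp]
    exact hbound t ht
  exact (integrable_norm_iff hf.aestronglyMeasurable).1 h1

/-! ### The integrand of the Hankel integral -/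

/-- The integrand `A_{H_q,k}(s) e^{s l}`. -/
def kernelExp (q β : ℂ) (k : ℤ) (l s : ℂ) : ℂ := kernel q β k s * exp (s * l)

theorem kernel_eq (q β : ℂ) (k : ℤ) (s : ℂ) :
    kernel q β k s = (-β) ^ (1 - k) * Gamma (1 - (k : ℂ) - s) * kernelProd q β s := rfl

section Kernel

variable {q β : ℂ} (hq0 : q ≠ 0) (hq1 : ‖q‖ < 1) (hβ : β ≠ 0)
  (hdist : Summable fun m : ℕ => Real.exp (-(2 * Real.pi *
      Metric.infDist (pole q β m) posRay)))

include hq0 hq1 hβ hdist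

theorem differentiableAt_kernel (k : ℤ) {s : ℂ} (hs : ∀ j : ℕ, s ≠ 1 - (k : ℂ) + j) :
    DifferentiableAt ℂ (kernel q β k) s := by
  have h1 : DifferentiableAt ℂ (fun s : ℂ => Gamma (1 - (k : ℂ) - s)) s := by
    refine (differentiableAt_Gamma _ fun m hm => hs m ?_).comp s (differentiableAt_id.const_sub _)
    linear_combination -hm
  have h2 := (differentiable_kernelProd hq0 hq1 hβ hdist) s
  have e : kernel q β k = fun s => (-β) ^ (1 - k) * Gamma (1 - (k : ℂ) - s) * kernelProd q β s :=
    rfl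
  rw [e]
  exact (h1.const_mul _).mul h2

theorem differentiableAt_kernelExp (k : ℤ) (l : ℂ) {s : ℂ} (hs : ∀ j : ℕ, s ≠ 1 - (k : ℂ) + j) :
    DifferentiableAt ℂ (kernelExp q β k l) s :=
  (differentiableAt_kernel hq0 hq1 hβ hdist k hs).mul (by fun_prop)

theorem continuous_kernelExp_comp (k : ℤ) (l : ℂ) {γ : ℝ → ℂ} (hγ : Continuous γ)
    (h : ∀ t, ∀ j : ℕ, γ t ≠ 1 - (k : ℂ) + j) : Continuous fun t => kernelExp q β k l (γ t) :=
  continuous_iff_continuousAt.2 fun t =>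
    (differentiableAt_kernelExp hq0 hq1 hβ hdist k l (h t)).continuousAt.comp hγ.continuousAt

theorem kernelExp_add_one (k : ℤ) (l : ℂ) {s : ℂ} (hP : qPochInf q (s * β) ≠ 0)
    (hs : -(k : ℂ) - s ≠ 0) :
    kernelExp q β k l (s + 1) =
      kernelExp q β k l s * (quantumExp q (s * β) * exp l / (-k - s)) := by
  have h1 := kernelProd_eq_mul hq0 hq1 hβ hdist s
  have h2 := Gamma_add_one _ hs
  rw [show -(k : ℂ) - s + 1 = 1 - k - s by ring] at h2
  rw [kernelExp, kernelExp, kernel_eq, kernel_eq, h1, h2, quantumExp_eq_inv hq1,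
    show 1 - (k : ℂ) - (s + 1) = -k - s by ring, add_mul s 1 l, one_mul, exp_add]
  generalize qPochInf q (s * β) = P at hP
  field_simp

theorem exists_norm_kernelExp_add_one_le (k : ℤ) (l : ℂ) (δ : ℝ) :
    ∃ N : ℝ, ∀ s : ℂ, |s.im| ≤ δ → N ≤ s.re →
      ‖kernelExp q β k l (s + 1)‖ ≤ Real.exp (-1) * ‖kernelExp q β k l s‖ := by
  obtain ⟨N, -, hN⟩ := exists_forall_norm_quantumExp_le hq0 hq1 hβ hdist δ
    (show 0 < Real.exp (-1) / ‖exp l‖ from div_pos (Real.exp_pos _) (norm_pos_iff.2 (exp_ne_zero l)))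
  refine ⟨max N (1 - k), fun s hs hNs => ?_⟩
  have h1 := (le_max_left _ _).trans hNs
  have h2 := (le_max_right _ _).trans hNs
  obtain ⟨hP, hH⟩ := hN s hs h1
  have hk : 1 ≤ ‖-(k : ℂ) - s‖ := by
    have := (neg_le_abs _).trans (abs_re_le_norm (-(k : ℂ) - s))
    simp only [sub_re, neg_re, intCast_re] at this
    linarith
  have hl : 0 < ‖exp l‖ := norm_pos_iff.2 (exp_ne_zero l)
  rw [kernelExp_add_one hq0 hq1 hβ hdist k l hP (norm_pos_iff.1 (by linarith)), norm_mul, mul_comm]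
  gcongr
  rw [norm_div, norm_mul]
  calc ‖quantumExp q (s * β)‖ * ‖exp l‖ / ‖-(k : ℂ) - s‖
      ≤ ‖quantumExp q (s * β)‖ * ‖exp l‖ := div_le_self (by positivity) hk
    _ ≤ Real.exp (-1) / ‖exp l‖ * ‖exp l‖ := by gcongr
    _ = Real.exp (-1) := div_mul_cancel₀ _ hl.ne'

omit hq0 hq1 hβ hdist in
theorem ne_one_sub_add_natCast_of_im_ne_zero (k : ℤ) {s : ℂ} (hs : s.im ≠ 0) (j : ℕ) :
    s ≠ 1 - (k : ℂ) + j := by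
  rintro rfl
  simp at hs

theorem continuous_kernelExp_horizontal (k : ℤ) (l : ℂ) {η : ℝ} (hη : η ≠ 0) :
    Continuous fun t : ℝ => kernelExp q β k l (t + η * I) :=
  continuous_kernelExp_comp hq0 hq1 hβ hdist k l (by fun_prop) fun t =>
    ne_one_sub_add_natCast_of_im_ne_zero k (by simpa using hη)

theorem integrableOn_kernelExp_horizontal (k : ℤ) (l : ℂ) {η : ℝ} (hη : η ≠ 0) (a : ℝ) :
    IntegrableOn (fun t : ℝ => kernelExp q β k l (t + η * I)) (Ioi a) := by
  obtain ⟨N, hN⟩ := exists_norm_kernelExp_add_one_le hq0 hq1 hβ hdist k l |η|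
  refine integrableOn_Ioi_of_norm_add_one_le
    (continuous_kernelExp_horizontal hq0 hq1 hβ hdist k l hη) (N := N) (fun t ht => ?_) a
  have := hN (t + η * I) (by simp) (by simpa using ht)
  rwa [show (t : ℂ) + η * I + 1 = ((t + 1 : ℝ) : ℂ) + η * I by push_cast; ring] at this

theorem continuous_kernelExp_vertical (k : ℤ) (l : ℂ) {c : ℝ} (hc : ∀ j : ℕ, c ≠ 1 - k + j) :
    Continuous fun y : ℝ => kernelExp q β k l (c + y * I) := by
  refine continuous_kernelExp_comp hq0 hq1 hβ hdist k l (by fun_prop) fun t j h => hc j ?_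
  have := congrArg re h
  simpa using this

omit hq0 hq1 hβ hdist in
theorem add_half_ne_add_natCast (k : ℤ) (n : ℕ) (j : ℕ) :
    (1 - k + n + 1 / 2 : ℝ) ≠ 1 - k + j := by
  intro h
  have h1 : (2 * n + 1 : ℝ) = 2 * j := by linarith
  have h2 : 2 * n + 1 = 2 * j := by exact_mod_cast h1
  omega

/-- Half-integer offsets avoid the poles. Each unit shift gains a factor $e^{-1}$ uniformly on the
segment, starting from a compact segment at `n₀`. -/
theorem tendsto_integral_kernelExp_vertical (k : ℤ) (l : ℂ) {δ : ℝ} (hδ : 0 < δ) :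
    Tendsto (fun n : ℕ => ∫ y : ℝ in (-δ)..δ,
      kernelExp q β k l ((1 - k + n + 1 / 2 : ℝ) + y * I)) atTop (𝓝 0) := by
  obtain ⟨N, hN⟩ := exists_norm_kernelExp_add_one_le hq0 hq1 hβ hdist k l δ
  obtain ⟨n₀, hn₀⟩ := exists_nat_ge (N - (1 - k + 1 / 2))
  obtain ⟨M, hM⟩ := (isCompact_Icc (a := -δ) (b := δ)).exists_bound_of_continuousOn
    (continuous_kernelExp_vertical hq0 hq1 hβ hdist k l (add_half_ne_add_natCast k n₀)).continuousOn
  have hbound : ∀ n : ℕ, ∀ y ∈ Icc (-δ) δ,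
      ‖kernelExp q β k l ((1 - k + (n + n₀ : ℕ) + 1 / 2 : ℝ) + y * I)‖ ≤ M * Real.exp (-1) ^ n := by
    intro n y hy
    induction n with
    | zero => simpa using hM y hy
    | succ n ih =>
      have h := hN ((1 - k + (n + n₀ : ℕ) + 1 / 2 : ℝ) + y * I)
        (by simpa [abs_le] using hy) (by
          simp
          linarith [(Nat.cast_nonneg n : (0 : ℝ) ≤ n)])
      rw [show (((1 - k + (n + n₀ : ℕ) + 1 / 2 : ℝ) : ℂ) + y * I + 1) =
        ((1 - k + (n + 1 + n₀ : ℕ) + 1 / 2 : ℝ) : ℂ) + y * I by push_cast; ring] at h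
      refine h.trans ?_
      calc _ ≤ Real.exp (-1) * (M * Real.exp (-1) ^ n) := by gcongr
        _ = _ := by ring
  rw [← tendsto_add_atTop_iff_nat n₀]
  have hlim : Tendsto (fun n : ℕ => M * Real.exp (-1) ^ n * |δ - -δ|) atTop (𝓝 0) := by
    have := ((tendsto_pow_atTop_nhds_zero_of_lt_one (Real.exp_pos (-1)).le
      (by simp)).const_mul M).mul_const |δ - -δ|
    simpa using this
  refine squeeze_zero_norm (fun n => ?_) hlim
  refine intervalIntegral.norm_integral_le_of_norm_le_const fun y hy => hbound n y ?_
  rw [uIoc_of_le (by linarith)] at hy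
  exact ⟨hy.1.le, hy.2⟩

theorem rectIntegral_kernelExp
    (hpole : ∀ j m : ℕ, 1 ≤ j → (j : ℂ) * β * q ^ m ≠ 1) (k : ℤ) {l x : ℂ}
    (hx : x ≠ 0) (hl : exp l = -x) (j : ℕ) {a b δ : ℝ} (hδ : 0 < δ)
    (ha : a < 1 - k + j) (hb : 1 - k + j < b) (hb' : b < 1 - k + j + 1)
    (haj : j = 0 ∨ 1 - k + j - 1 < a) :
    rectIntegral (kernelExp q β k l) a b δ =
      -(2 * Real.pi * I * phiTerm (quantumExp q) β k x j) := by
  obtain ⟨h, hd, hv, hG⟩ := exists_Gamma_neg_eq_div j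
  set p : ℝ := 1 - k + j with hp
  have hpC : (p : ℂ) = 1 - k + j := by rw [hp]; push_cast; ring
  set g : ℂ → ℂ := fun s =>
    (-β) ^ (1 - k) * h (s - (1 - k)) * kernelProd q β s * exp (s * l) with hg
  have hdom : ∀ s ∈ uIcc a b ×ℂ uIcc (-δ) δ,
      (s - (1 - k)).re < j + 1 ∧ ∀ i < j, s - (1 - k) ≠ (i : ℂ) := by
    intro s hs
    rw [mem_reProdIm, uIcc_of_le (by linarith)] at hs
    obtain ⟨⟨h1, h2⟩, -⟩ := hs
    refine ⟨?_, fun i hij he => ?_⟩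
    · simp only [sub_re, one_re, intCast_re]
      linarith
    · have h3 := congrArg re he
      simp only [sub_re, one_re, intCast_re, natCast_re] at h3
      have h4 : (i : ℝ) + 1 ≤ j := by exact_mod_cast hij
      rcases haj with rfl | h5
      · omega
      · linarith
  have hgd : DifferentiableOn ℂ g (uIcc a b ×ℂ uIcc (-δ) δ) := by
    have h1 : DifferentiableOn ℂ (fun s : ℂ => h (s - (1 - k))) (uIcc a b ×ℂ uIcc (-δ) δ) :=
      hd.comp (by fun_prop) hdom
    refine ((h1.const_mul _).mul
      (differentiable_kernelProd hq0 hq1 hβ hdist).differentiableOn).mul ?_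
    fun_prop
  rw [rectIntegral_eq_of_simple_pole (g := g) hδ ha hb hgd]
  · have hF := kernelProd_intCast_add_one hq0 hq1 hβ hdist hpole ((j : ℤ) - k)
    rw [show (((j : ℤ) - k : ℤ) : ℂ) + 1 = 1 - k + j by push_cast; ring] at hF
    -- The exponent is an integer at the pole, so the choice of $l$ has no effect.
    have hexp : exp ((1 - k + j) * l) = (-x) ^ (1 - k + (j : ℤ)) := by
      rw [← hl, ← exp_int_mul]
      push_cast
      rfl
    -- The signs from $(-x)^s$, from $(-\beta)^{1-k}$ and from the residue of $\Gamma$ cancel.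
    have hsq : ((-1 : ℂ) ^ (1 - k + (j : ℤ))) * ((-1) ^ (1 - k) * (-1) ^ j) = 1 := by
      rw [← zpow_natCast, ← zpow_add₀ (by norm_num), ← mul_zpow]
      norm_num
    have hb1 : β ^ ((j : ℤ) - k) = β ^ j * β ^ (1 - k) / β := by
      rw [show (j : ℤ) - k = (j : ℤ) + (1 - k) - 1 by ring, zpow_sub_one₀ hβ, zpow_add₀ hβ,
        zpow_natCast]
      rfl
    simp only [hg]
    rw [hpC, show (1 - (k : ℂ) + j) - (1 - k) = j by ring, hv, hexp, phiTerm, ← hF, hb1,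
      neg_eq_neg_one_mul β, neg_eq_neg_one_mul x, mul_zpow, mul_zpow, zpow_add₀ hx, zpow_natCast,
      div_pow]
    have hf : (j.factorial : ℂ) ≠ 0 := Nat.cast_ne_zero.2 j.factorial_ne_zero
    field_simp
    linear_combination -(kernelProd q β (1 - k + j) * hsq)
  · intro s hs hne
    have h1 := hG (s - (1 - k)) (hdom s hs).2 (fun he => hne (by
      rw [hpC]
      linear_combination he))
    rw [show -(s - (1 - (k : ℂ))) = 1 - k - s by ring] at h1
    rw [kernelExp, kernel_eq, h1, hpC, hg, show s - (1 - (k : ℂ)) - j = s - (1 - k + j) by ring]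
    ring

theorem rectIntegral_kernelExp_eq_sum
    (hpole : ∀ j m : ℕ, 1 ≤ j → (j : ℂ) * β * q ^ m ≠ 1) (k : ℤ) {l x : ℂ}
    (hx : x ≠ 0) (hl : exp l = -x) {a δ : ℝ} (hδ : 0 < δ) (ha : a < 1 - k) (n : ℕ) :
    rectIntegral (kernelExp q β k l) a (1 - k + n + 1 / 2) δ =
      -(2 * Real.pi * I * ∑ j ∈ Finset.range (n + 1), phiTerm (quantumExp q) β k x j) := by
  induction n with
  | zero =>
    rw [rectIntegral_kernelExp hq0 hq1 hβ hdist hpole k hx hl 0 hδ (by simpa using ha)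
      (by simp) (by push_cast; linarith) (Or.inl rfl)]
    simp
  | succ n ih =>
    have h := rectIntegral_kernelExp hq0 hq1 hβ hdist hpole k hx hl (n + 1) hδ
      (a := 1 - k + n + 1 / 2) (b := 1 - k + (n + 1 : ℕ) + 1 / 2) (by push_cast; linarith)
      (by linarith) (by linarith) (Or.inr (by push_cast; linarith))
    have c1 := continuous_kernelExp_horizontal hq0 hq1 hβ hdist k l (neg_ne_zero.2 hδ.ne')
    have c2 := continuous_kernelExp_horizontal hq0 hq1 hβ hdist k l hδ.ne'
    simp only [ofReal_neg, neg_mul, ← sub_eq_add_neg] at c1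
    rw [← rectIntegral_add_adjacent c1 c2, ih, h, Finset.sum_range_succ _ (n + 1)]
    ring

theorem hankelIntegrable_kernelExp (k : ℤ) (l : ℂ) {a δ : ℝ} (hδ : 0 < δ) (ha : a < 1 - k) :
    HankelIntegrable (kernelExp q β k l) a δ := by
  refine ⟨?_, ?_, integrableOn_kernelExp_horizontal hq0 hq1 hβ hdist k l hδ.ne' a⟩
  · have := integrableOn_kernelExp_horizontal hq0 hq1 hβ hdist k l (neg_ne_zero.2 hδ.ne') a
    simpa only [ofReal_neg, neg_mul, ← sub_eq_add_neg] using this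
  · refine (continuous_kernelExp_vertical hq0 hq1 hβ hdist k l fun j h => ?_).intervalIntegrable _ _
    have : (0 : ℝ) ≤ j := Nat.cast_nonneg j
    linarith

theorem hankelIntegral_kernelExp
    (hpole : ∀ j m : ℕ, 1 ≤ j → (j : ℂ) * β * q ^ m ≠ 1) (k : ℤ) {l x : ℂ}
    (hx : x ≠ 0) (hl : exp l = -x) {a δ : ℝ} (hδ : 0 < δ) (ha : a < 1 - k) {S : ℂ}
    (hS : HasSum (phiTerm (quantumExp q) β k x) S) :
    hankelIntegral (kernelExp q β k l) a δ = 2 * Real.pi * I * S := by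
  obtain ⟨i1, -, i2⟩ := hankelIntegrable_kernelExp hq0 hq1 hβ hdist k l hδ ha
  have hb : Tendsto (fun n : ℕ => (1 - k + n + 1 / 2 : ℝ)) atTop atTop :=
    tendsto_atTop_add_const_right _ _ (tendsto_atTop_add_const_left _ _ tendsto_natCast_atTop_atTop)
  have t1 := intervalIntegral_tendsto_integral_Ioi a i1 hb
  have t2 := intervalIntegral_tendsto_integral_Ioi a i2 hb
  have t3 := (tendsto_integral_kernelExp_vertical hq0 hq1 hβ hdist k l hδ).const_mul I
  have t4 := ((t1.sub t2).add t3).sub_const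
    (I * ∫ y : ℝ in (-δ)..δ, kernelExp q β k l (a + y * I))
  have t5 : Tendsto (fun n : ℕ => rectIntegral (kernelExp q β k l) a (1 - k + n + 1 / 2) δ) atTop
      (𝓝 (-(2 * Real.pi * I * S))) := by
    simp only [rectIntegral_kernelExp_eq_sum hq0 hq1 hβ hdist hpole k hx hl hδ ha]
    exact ((hS.tendsto_sum_nat.comp (tendsto_add_atTop_nat 1)).const_mul _).neg
  have h := tendsto_nhds_unique t4 t5
  rw [hankelIntegral, intervalIntegral.integral_mul_const]
  -- The Hankel contour runs clockwise, so its integral is minus the limit of the rectangle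
  -- integrals; this absorbs the minus sign of the residues.
  linear_combination -h

end Kernel

end QuantumHurwitz

end

theorem mainTheorem4 (q β : ℂ) (hq0 : q ≠ 0) (hq1 : ‖q‖ < 1) (hβ : β ≠ 0)
    (hpole : ∀ j m : ℕ, 1 ≤ j → (j : ℂ) * β * q ^ m ≠ 1)
    (hdist : Summable fun m : ℕ => Real.exp (-(2 * Real.pi *
      Metric.infDist (β⁻¹ * (q ^ m)⁻¹) ((fun t : ℝ => (t : ℂ)) '' Set.Ici (0 : ℝ)))))
    (k : ℤ) :
    (∀ s : ℂ, Multipliable (QuantumHurwitz.kernelFactor q β s)) ∧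
    DifferentiableOn ℂ (QuantumHurwitz.kernel q β k)
      {s : ℂ | ∀ j : ℕ, s ≠ 1 - (k : ℂ) + (j : ℂ)} ∧
    (∀ ζ : ℂ, ζ ≠ 0 →
      Summable (QuantumHurwitz.rhoTerm (QuantumHurwitz.quantumExp q) β k ζ)) ∧
    ∀ (ε : ℝ), 0 < ε → ∀ x : ℂ, x ≠ 0 →
      HasSum (QuantumHurwitz.phiTerm (QuantumHurwitz.quantumExp q) β k x)
        (QuantumHurwitz.phi (QuantumHurwitz.quantumExp q) β k ε x) ∧
      ∀ l : ℂ, Complex.exp l = -x →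
        ∀ a δ : ℝ, a < 1 - (k : ℝ) → 0 < δ →
          QuantumHurwitz.HankelIntegrable
            (fun s : ℂ => QuantumHurwitz.kernel q β k s * Complex.exp (s * l)) a δ ∧
          QuantumHurwitz.phi (QuantumHurwitz.quantumExp q) β k ε x =
            1 / (2 * Real.pi * Complex.I) *
              QuantumHurwitz.hankelIntegral
                (fun s : ℂ => QuantumHurwitz.kernel q β k s * Complex.exp (s * l)) a δ := by
  refine ⟨QuantumHurwitz.multipliable_kernelFactor hq0 hq1 hβ hdist, fun s hs =>
    (QuantumHurwitz.differentiableAt_kernel hq0 hq1 hβ hdist k hs).differentiableWithinAt,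
    fun ζ hζ => QuantumHurwitz.summable_rhoTerm hq0 hq1 hβ hdist k hζ, fun ε hε x hx => ?_⟩
  have hsum := QuantumHurwitz.hasSum_phiTerm hq0 hq1 hβ hdist k hε hx
  refine ⟨hsum, fun l hl a δ ha hδ =>
    ⟨QuantumHurwitz.hankelIntegrable_kernelExp hq0 hq1 hβ hdist k l hδ ha, ?_⟩⟩
  have h := QuantumHurwitz.hankelIntegral_kernelExp hq0 hq1 hβ hdist hpole k hx hl hδ ha hsum
  change _ = 1 / (2 * Real.pi * Complex.I) *
    QuantumHurwitz.hankelIntegral (QuantumHurwitz.kernelExp q β k l) a δ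
  rw [h, one_div, inv_mul_cancel_left₀ Complex.two_pi_I_ne_zero]
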